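/- Setting. Consider a bandit with $K$ arms, slots $t=1,2,\dots$, loads $L_t\in[0,1]$ that are i.i.d. over time (with an arbitrary, for instance continuous, distribution), and nominal rewards $X_{k,t}\in[0,1]$ that are independent across arms, i.i.d. over time with mean $\mathbb{E}[X_{k,t}]=u_k$, and independent of the loads. One arm, called arm $1$ without loss of generality, is strictly the best: $u_1>u_k$ for all $k>1$; put $\Delta_k=u_1-u_k$. In slot $t$ the agent observes $L_t$, pulls an arm $a_t$ that is a (measurable) function of $L_t$ and of the history $(L_1,a_1,X_{a_1,1},\dots,L_{t-1},a_{t-1},X_{a_{t-1},t-1})$, observes $X_{a_t,t}$ and receives the reward $L_tX_{a_t,t}$. The regret is $R(T)=u_1\,\mathbb{E}\big[\sum_{t=1}^T L_t\big]-\sum_{t=1}^T\mathbb{E}[L_tX_{a_t,t}]$. AdaUCB with parameter $\alpha$ and a single threshold $l^{(-)}=l^{(+)}$ pulls each arm once in the first $K$ slots, and in every slot $t>K$ it pulls an arm $k$ that maximizes $$\hat u_k(t)=\bar u_k(t)+\sqrt{\frac{\alpha(1-\tilde L_t)\log t}{C_k(t-1)}},$$ where $C_k(t-1)$ is the number of pulls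 of arm $k$ before slot $t$, $\bar u_k(t)$ is the empirical mean of the rewards $X_{k,\tau}$ observed in these pulls, and $\tilde L_t=0$ if $L_t\le l^{(-)}$, $\tilde L_t=1$ if $L_t>l^{(-)}$ (ties are broken by any measurable rule that depends on $L_t$ only through $\tilde L_t$ and otherwise on the history). Theorem. Let $\alpha>2$ and $\mathbb{P}(L_t\le l^{(-)})=\rho>0$. Then there is a constant $C$, which depends only on $K$, $\alpha$, $\rho$ and $u_1,\dots,u_K$, such that for all $T\ge1$ $$R(T)\le 4\alpha\log T\;\mathbb{E}\big[L_t\mid L_t\le l^{(-)}\big]\sum_{k>1}\frac1{\Delta_k}+C .$$ Moreover, the part of the regret that is incurred at high load is bounded: $\sum_{t=1}^T\mathbb{E}\big[\mathbf 1\{L_t>l^{(-)}\}\,L_t\,(u_1-X_{a_t,t})\big]\le C$ for all $T\ge1$. -/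

import Mathlib

open MeasureTheory ProbabilityTheory

noncomputable section

namespace OpportunisticBandit

/-- A history of `n` past slots of a bandit with `K` arms: for each past slot, the load, the arm
that was pulled, and the nominal reward that was observed. Slots are numbered from `0`, so that
entry `i` describes the slot that is slot `i + 1` in numbering from one. -/
abbrev History (K n : ℕ) : Type := Fin n → ℝ × Fin K × ℝ

/-- A policy: in the slot that follows `n` past slots it chooses an arm as a function of the
history of these slots and of the load of the current slot. -/
abbrev Policy (K : ℕ) : Type := (n : ℕ) → History K n → ℝ → Fin K

/-- The history of the first `n` slots when the policy `Γ` is run against the loads `ℓ` and the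
nominal rewards `x`. -/
def history {K : ℕ} (Γ : Policy K) (ℓ : ℕ → ℝ) (x : Fin K → ℕ → ℝ) : (n : ℕ) → History K n
  | 0 => Fin.elim0
  | n + 1 =>
    Fin.snoc (α := fun _ => ℝ × Fin K × ℝ) (history Γ ℓ x n)
      (ℓ n, Γ n (history Γ ℓ x n) (ℓ n), x (Γ n (history Γ ℓ x n) (ℓ n)) n)

/-- The arm pulled by the policy `Γ` in slot `n` (numbered from `0`). -/
def pulledArm {K : ℕ} (Γ : Policy K) (ℓ : ℕ → ℝ) (x : Fin K → ℕ → ℝ) (n : ℕ) : Fin K :=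
  Γ n (history Γ ℓ x n) (ℓ n)

/-- The number of pulls of arm `k` in a history. -/
def pullCount {K n : ℕ} (h : History K n) (k : Fin K) : ℕ :=
  (Finset.univ.filter fun i => (h i).2.1 = k).card

/-- The empirical mean of the observed nominal rewards of arm `k` in a history. -/
def empiricalMean {K n : ℕ} (h : History K n) (k : Fin K) : ℝ :=
  (∑ i ∈ Finset.univ.filter (fun i => (h i).2.1 = k), (h i).2.2) / (pullCount h k : ℝ)

/-- The load `y`, truncated to `[lm, lp]` and normalized to `[0, 1]`; when the two thresholds
coincide, it is `0` up to the threshold and `1` above it. -/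
def normalizedLoad (lm lp y : ℝ) : ℝ :=
  if lp = lm then (if y ≤ lm then 0 else 1) else (max lm (min y lp) - lm) / (lp - lm)

/-- The index that AdaUCB gives to arm `k` after `n` past slots, hence in slot `n + 1` in
numbering from one, when the current load is `y`. -/
def adaIndex (α lm lp : ℝ) {K n : ℕ} (h : History K n) (y : ℝ) (k : Fin K) : ℝ :=
  empiricalMean h k +
    √(α * (1 - normalizedLoad lm lp y) * Real.log ((n : ℝ) + 1) / (pullCount h k : ℝ))

/-- `Γ` is an AdaUCB policy with exploration parameter `α` and thresholds `lm`, `lp`: in the first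
`K` slots each arm is pulled once, in any order, and afterwards an arm with the largest index is
pulled. Ties are broken by any measurable rule that, like the indices, depends on the current load
only through the normalized load. -/
structure IsAdaUCB {K : ℕ} (α lm lp : ℝ) (Γ : Policy K) : Prop where
  measurable : ∀ n, Measurable fun p : History K n × ℝ => Γ n p.1 p.2
  initial : ∀ n, n < K → ∀ (h : History K n) (y : ℝ) (i : Fin n), Γ n h y ≠ (h i).2.1
  argmax : ∀ n, K ≤ n → ∀ (h : History K n) (y : ℝ) (k : Fin K),
    adaIndex α lm lp h y k ≤ adaIndex α lm lp h y (Γ n h y)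
  load_only_normalized : ∀ n, K ≤ n → ∀ (h : History K n) (y y' : ℝ),
    normalizedLoad lm lp y = normalizedLoad lm lp y' → Γ n h y = Γ n h y'

/-- The stochastic model: loads `L n` that are i.i.d. over time with values in `[0, 1]`, and
nominal rewards `X k n` with values in `[0, 1]` and means `u k` that are independent across arms
and over time, identically distributed over time for each arm, and independent of the loads. -/
structure IsModel {K : ℕ} {Ω : Type*} [MeasurableSpace Ω] (P : Measure Ω)
    (L : ℕ → Ω → ℝ) (X : Fin K → ℕ → Ω → ℝ) (u : Fin K → ℝ) : Prop where
  measurable_load : ∀ n, Measurable (L n)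
  measurable_reward : ∀ k n, Measurable (X k n)
  load_mem : ∀ n ω, L n ω ∈ Set.Icc (0 : ℝ) 1
  reward_mem : ∀ k n ω, X k n ω ∈ Set.Icc (0 : ℝ) 1
  indep_load : iIndepFun L P
  ident_load : ∀ n, IdentDistrib (L n) (L 0) P P
  indep_reward : iIndepFun (fun i : Fin K × ℕ => X i.1 i.2) P
  ident_reward : ∀ k n, IdentDistrib (X k n) (X k 0) P P
  indep_load_reward :
    IndepFun (fun ω (n : ℕ) => L n ω) (fun ω (i : Fin K × ℕ) => X i.1 i.2 ω) P
  mean_reward : ∀ k n, ∫ ω, X k n ω ∂P = u k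

/-- The nominal reward that the policy `Γ` receives in slot `n` (numbered from `0`). -/
def receivedReward {K : ℕ} {Ω : Type*} (Γ : Policy K) (L : ℕ → Ω → ℝ)
    (X : Fin K → ℕ → Ω → ℝ) (n : ℕ) (ω : Ω) : ℝ :=
  X (pulledArm Γ (fun m => L m ω) (fun k m => X k m ω) n) n ω

/-- The regret of the policy `Γ` over the first `T` slots. -/
def regret {K : ℕ} {Ω : Type*} [MeasurableSpace Ω] (P : Measure Ω) (L : ℕ → Ω → ℝ)
    (X : Fin K → ℕ → Ω → ℝ) (u : Fin K → ℝ) (Γ : Policy K) (T : ℕ) : ℝ :=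
  (⨆ k, u k) * ∫ ω, (∑ n ∈ Finset.range T, L n ω) ∂P -
    ∑ n ∈ Finset.range T, ∫ ω, L n ω * receivedReward Γ L X n ω ∂P

/-- The part of the regret of `Γ` over the first `T` slots that is incurred in the slots whose
load exceeds `l`. -/
def highLoadRegret {K : ℕ} {Ω : Type*} [MeasurableSpace Ω] (P : Measure Ω) (L : ℕ → Ω → ℝ)
    (X : Fin K → ℕ → Ω → ℝ) (u : Fin K → ℝ) (Γ : Policy K) (l : ℝ) (T : ℕ) : ℝ :=
  ∑ n ∈ Finset.range T,
    ∫ ω in {ω | l < L n ω}, L n ω * ((⨆ k, u k) - receivedReward Γ L X n ω) ∂P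

end OpportunisticBandit

end

noncomputable section

namespace OpportunisticBandit


/-! At low load the policy is UCB, at high load it is greedy. Everything rests on the event
`moderateNoise`: for every arm the centred reward sum over its first `s` pulls is at most `1.05 √(s
log (t+1))` in absolute value, and its growth over the last `d` pulls before `t` is at most `√(1.6 d
log (t+1))`. The pulls in a fixed window of counts form a predictable set of slots, so an
exponential supermartingale (`integral_exp_predictable_le_one`) gives Hoeffding tails for each
window. A union bound over windows makes the failure probability `O(t ^ (-1.2))`, which is summable.

Low load: under moderate noise the usual UCB comparison (`low_load_count_le`) allows a suboptimal
arm to be pulled only while its count is at most `4 α log T / Δ²`. Given that the load is low, the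
pulled arm does not depend on its exact value, so the expected loss factors and the conditional mean
load appears (`IsModel.integral_low_load`).

High load: the exploration done at low load must keep the greedy choice correct
(`high_load_pull_eq_best`). Suppose that a suboptimal arm `k` wins at high load in slot `t`.
Linearly many slots of the second half of the past had low load, and only `O(log t)` of them went to
suboptimal arms, so the best arm is known up to a small error. At the last low-load pull `τ` of the
best arm, `k` lost in spite of its bonus, so its noise per pull was below the gap by about that
bonus; at `t` its noise per pull has reached about the gap. `false_of_noise_excursion` shows that
moderate noise excludes such a climb. What remains are probabilities that are summable in `t`. -/

/-- The number of indices below `n` at which the sequence of arms `a` pulls `k`. -/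
def armCount {K : ℕ} (a : ℕ → Fin K) (k : Fin K) (n : ℕ) : ℕ :=
  ((Finset.range n).filter fun i => a i = k).card

/-- The sum of the noise `y k` over the indices below `n` at which `a` pulls `k`. -/
def noiseSum {K : ℕ} (a : ℕ → Fin K) (y : Fin K → ℕ → ℝ) (k : Fin K) (n : ℕ) : ℝ :=
  ∑ i ∈ (Finset.range n).filter (fun i => a i = k), y k i

theorem history_apply {K : ℕ} (Γ : Policy K) (ℓ : ℕ → ℝ) (x : Fin K → ℕ → ℝ) (n : ℕ) (i : Fin n) :
    history Γ ℓ x n i = (ℓ i, pulledArm Γ ℓ x i, x (pulledArm Γ ℓ x i) i) := by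
  induction n with
  | zero => exact i.elim0
  | succ n ih =>
    refine Fin.lastCases ?_ (fun j => ?_) i
    · simp [history, pulledArm]
    · rw [history, Fin.snoc_castSucc, ih j]; simp

theorem pullCount_history {K : ℕ} (Γ : Policy K) (ℓ : ℕ → ℝ) (x : Fin K → ℕ → ℝ) (n : ℕ)
    (k : Fin K) : pullCount (history Γ ℓ x n) k = armCount (pulledArm Γ ℓ x) k n := by
  simp only [pullCount, armCount, history_apply, Finset.card_filter]
  exact Fin.sum_univ_eq_sum_range (fun i => if pulledArm Γ ℓ x i = k then 1 else 0) n

theorem empiricalMean_history {K : ℕ} (Γ : Policy K) (ℓ : ℕ → ℝ) (x : Fin K → ℕ → ℝ)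
    (u : Fin K → ℝ) (n : ℕ) (k : Fin K) (hk : 1 ≤ armCount (pulledArm Γ ℓ x) k n) :
    empiricalMean (history Γ ℓ x n) k =
      u k + noiseSum (pulledArm Γ ℓ x) (fun k i => x k i - u k) k n /
        armCount (pulledArm Γ ℓ x) k n := by
  have h0 : (armCount (pulledArm Γ ℓ x) k n : ℝ) ≠ 0 := by positivity
  have h1 : ∑ i ∈ Finset.univ.filter (fun i => (history Γ ℓ x n i).2.1 = k),
      (history Γ ℓ x n i).2.2 =
      ∑ i ∈ (Finset.range n).filter (fun i => pulledArm Γ ℓ x i = k), x k i := by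
    simp only [history_apply, Finset.sum_filter]
    rw [Fin.sum_univ_eq_sum_range
      (fun i => if pulledArm Γ ℓ x i = k then x (pulledArm Γ ℓ x i) i else 0) n]
    refine Finset.sum_congr rfl fun i _ => ?_
    split_ifs with h
    · rw [h]
    · rfl
  rw [empiricalMean, pullCount_history, h1, noiseSum, Finset.sum_sub_distrib, Finset.sum_const,
    nsmul_eq_mul]
  change _ = u k + (_ - (armCount (pulledArm Γ ℓ x) k n : ℝ) * u k) / _
  field_simp
  ring

/-! ### Counting pulls along a fixed sequence of arms. -/

section Counting

variable {K : ℕ} (a : ℕ → Fin K) (k : Fin K)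

theorem armCount_succ (n : ℕ) :
    armCount a k (n + 1) = armCount a k n + if a n = k then 1 else 0 := by
  simp only [armCount, Finset.card_filter, Finset.sum_range_succ]

theorem armCount_mono : Monotone (armCount a k) := by
  refine monotone_nat_of_le_succ fun n => ?_
  rw [armCount_succ]; omega

theorem armCount_lt {i n : ℕ} (hin : i < n) (hi : a i = k) : armCount a k i < armCount a k n := by
  have h := armCount_mono a k (Nat.succ_le_of_lt hin)
  rw [Nat.succ_eq_add_one, armCount_succ, if_pos hi] at h
  omega

theorem armCount_le (n : ℕ) : armCount a k n ≤ n := by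
  simpa [armCount] using Finset.card_filter_le (Finset.range n) fun i => a i = k

/-- Each pull raises the count, so a pull is identified by the count just before it. This turns
bounds on counts into bounds on numbers of pulls. -/
theorem armCount_injOn : Set.InjOn (armCount a k) {i | a i = k} := by
  intro i hi j hj hij
  rcases lt_trichotomy i j with h | h | h
  · exact absurd hij (armCount_lt a k h hi).ne
  · exact h
  · exact absurd hij (armCount_lt a k h hj).ne'

/-- An arm is pulled at most `B + 1` times while it has been pulled at most `B` times. -/
theorem card_le_of_armCount_le {s : Finset ℕ} {B : ℝ} (hB : 0 ≤ B)
    (hs : ∀ i ∈ s, a i = k ∧ (armCount a k i : ℝ) ≤ B) : (s.card : ℝ) ≤ B + 1 := by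
  have h : s.card ≤ (Finset.range (⌊B⌋₊ + 1)).card := by
    refine Finset.card_le_card_of_injOn (armCount a k) (fun i hi => ?_)
      ((armCount_injOn a k).mono fun i hi => (hs i hi).1)
    simpa [Nat.lt_succ_iff] using Nat.le_floor (hs i hi).2
  rw [Finset.card_range] at h
  calc (s.card : ℝ) ≤ (⌊B⌋₊ + 1 : ℕ) := by exact_mod_cast h
    _ ≤ B + 1 := by push_cast; linarith [Nat.floor_le hB]

variable {k} in
theorem card_le_armCount {s : Finset ℕ} {n : ℕ} (hs : ∀ i ∈ s, i < n ∧ a i = k) :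
    s.card ≤ armCount a k n :=
  Finset.card_le_card fun i hi => by simpa using hs i hi

/-- The number of pulls in a window of the count, which is the number of pulls between two
times. -/
theorem sum_window {n₁ n₂ t : ℕ} (h₁₂ : n₁ ≤ n₂) (h₂ : n₂ ≤ t) (f : ℕ → ℝ) :
    ∑ i ∈ Finset.range t, (if a i = k ∧ armCount a k n₁ ≤ armCount a k i ∧
        armCount a k i < armCount a k n₂ then f i else 0) =
      ∑ i ∈ (Finset.range n₂).filter (fun i => a i = k), f i -
        ∑ i ∈ (Finset.range n₁).filter (fun i => a i = k), f i := by
  have key : ∀ n ≤ t, ∑ i ∈ (Finset.range n).filter (fun i => a i = k), f i =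
      ∑ i ∈ Finset.range t, if a i = k ∧ i < n then f i else 0 := by
    intro n hn
    rw [← Finset.sum_filter]
    refine Finset.sum_congr ?_ fun _ _ => rfl
    ext i
    simp only [Finset.mem_filter, Finset.mem_range]
    grind
  rw [key n₂ h₂, key n₁ (h₁₂.trans h₂), ← Finset.sum_sub_distrib]
  refine Finset.sum_congr rfl fun i _ => ?_
  by_cases hi : a i = k
  · simp only [hi, true_and]
    rcases lt_or_ge i n₁ with h | h
    · have h' := armCount_lt a k h hi
      rw [if_neg (by omega), if_pos (by omega), if_pos h, sub_self]
    · have h' := armCount_mono a k h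
      rcases lt_or_ge i n₂ with g | g
      · have g' := armCount_lt a k g hi
        rw [if_pos (by omega), if_pos g, if_neg (by omega), sub_zero]
      · have g' := armCount_mono a k g
        rw [if_neg (by omega), if_neg (by omega), if_neg (by omega), sub_self]
  · simp [hi]

end Counting

/-- The first `K` pulls are pairwise distinct, and an injection of `Fin K` into itself is onto. From
slot `K` on, no index therefore involves a division by zero. -/
theorem one_le_armCount {K : ℕ} {α lm lp : ℝ} {Γ : Policy K} (hΓ : IsAdaUCB α lm lp Γ)
    (ℓ : ℕ → ℝ) (x : Fin K → ℕ → ℝ) {n : ℕ} (hn : K ≤ n) (k : Fin K) :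
    1 ≤ armCount (pulledArm Γ ℓ x) k n := by
  have hinj : Function.Injective fun i : Fin K => pulledArm Γ ℓ x i := by
    have hlt : ∀ i j : Fin K, i < j → pulledArm Γ ℓ x j ≠ pulledArm Γ ℓ x i := by
      intro i j hij
      have h := hΓ.initial j j.2 (history Γ ℓ x j) (ℓ j) ⟨i, hij⟩
      rwa [history_apply] at h
    intro i j hij
    rcases lt_trichotomy i j with h | h | h
    · exact absurd hij.symm (hlt i j h)
    · exact h
    · exact absurd hij (hlt j i h)
  obtain ⟨i, hi⟩ := (Finite.injective_iff_surjective.mp hinj) k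
  rw [Nat.one_le_iff_ne_zero, ← Nat.pos_iff_ne_zero, armCount, Finset.card_pos]
  exact ⟨i, by simpa using ⟨lt_of_lt_of_le i.2 hn, hi⟩⟩

/-! ### Deterministic analysis of the index comparisons at low and at high load. -/

/-- The noise of the empirical means stays within the exploration radius `√(α r / N)`, so that a
suboptimal arm that maximizes the index was pulled few times. -/
theorem count_le_of_index_le {α r Δ N₁ N₂ S₁ S₂ : ℝ} (hΔ : 0 < Δ) (hN₁ : 0 < N₁) (hN₂ : 0 < N₂)
    (hα : 0 ≤ α * r) (h₁ : |S₁| ≤ √(α * r * N₁)) (h₂ : |S₂| ≤ √(α * r * N₂))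
    (h : Δ + S₁ / N₁ + √(α * r / N₁) ≤ S₂ / N₂ + √(α * r / N₂)) :
    N₂ ≤ 4 * α * r / Δ ^ 2 := by
  have e : ∀ N, 0 < N → √(α * r * N) / N = √(α * r / N) := by
    intro N hN
    rw [Real.sqrt_mul hα, Real.sqrt_div hα, mul_div_assoc, Real.sqrt_div_self, div_eq_mul_inv]
  have g₁ : -√(α * r / N₁) ≤ S₁ / N₁ := by
    rw [← e N₁ hN₁, ← neg_div]
    exact div_le_div_of_nonneg_right (by linarith [neg_le_of_abs_le h₁]) hN₁.le
  have g₂ : S₂ / N₂ ≤ √(α * r / N₂) := by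
    rw [← e N₂ hN₂]
    exact div_le_div_of_nonneg_right (le_of_abs_le h₂) hN₂.le
  -- The bonus of the best arm absorbs its own noise, while the noise of the other arm at most
  -- doubles that arm's bonus. Squaring this 2 gives the 4 of the regret bound.
  have g : Δ ≤ 2 * √(α * r / N₂) := by linarith
  have g' : Δ ^ 2 ≤ 4 * (α * r / N₂) := by
    calc Δ ^ 2 ≤ (2 * √(α * r / N₂)) ^ 2 := pow_le_pow_left₀ hΔ.le g 2
      _ = 4 * (α * r / N₂) := by rw [mul_pow, Real.sq_sqrt (by positivity)]; norm_num
  rw [le_div_iff₀ (by positivity)]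
  have : 4 * (α * r / N₂) * N₂ = 4 * α * r := by field_simp
  nlinarith

/-- The noise of an arm cannot fall so low that exploration prefers the best arm, and then rise so
high that exploitation prefers the suboptimal arm. -/
theorem false_of_noise_excursion {r s t S T Δ ε : ℝ} (hr : 0 < r) (hs : 0 < s) (hst : s ≤ t)
    (hΔ : 0 < Δ) (hε : ε ≤ Δ / 200) (h₁ : S + 1.4 * √(r * s) ≤ s * (Δ + ε))
    (h₂ : t * (Δ - ε) ≤ T) (g₁ : |S| ≤ 1.05 * √(r * s)) (g₂ : |T| ≤ 1.05 * √(r * t))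
    (g : T - S ≤ √(1.6 * (t - s) * r)) : False := by
  rw [Real.sqrt_mul hr.le] at h₁ g₁ g₂
  have hw := Real.sqrt_nonneg (1.6 * (t - s) * r)
  have hw2 : √(1.6 * (t - s) * r) ^ 2 = 1.6 * (t - s) * r :=
    Real.sq_sqrt (mul_nonneg (by linarith) hr.le)
  have hm : 0 < √r := Real.sqrt_pos.2 hr
  have hp : 0 < √s := Real.sqrt_pos.2 hs
  have hq : 0 < √t := Real.sqrt_pos.2 (hs.trans_le hst)
  have hm2 : √r ^ 2 = r := Real.sq_sqrt hr.le
  have hp2 : √s ^ 2 = s := Real.sq_sqrt hs.le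
  have hq2 : √t ^ 2 = t := Real.sq_sqrt (hs.trans_le hst).le
  generalize √(1.6 * (t - s) * r) = w at *
  generalize √r = m at *
  generalize √s = p at *
  generalize √t = q at *
  subst hm2 hp2 hq2
  -- With `m = √r`, `p = √s`, `q = √t`: here 0.35 = 1.4 - 1.05, so the first comparison forces `p Δ`
  -- to be at least of order `m`, while `b` bounds `q Δ` from above by the same order.
  have a : 0.35 * m ≤ p * (1.005 * Δ) := by
    have : p * (0.35 * m) ≤ p * (p * (1.005 * Δ)) := by
      nlinarith [neg_le_of_abs_le g₁, mul_le_mul_of_nonneg_left hε (sq_nonneg p)]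
    exact le_of_mul_le_mul_left this hp
  have b : q * (0.995 * Δ) ≤ 1.05 * m := by
    have : q * (q * (0.995 * Δ)) ≤ q * (1.05 * m) := by
      nlinarith [le_of_abs_le g₂, mul_le_mul_of_nonneg_left hε (sq_nonneg q)]
    exact le_of_mul_le_mul_left this hq
  -- The inequality `4 x y ≤ (x + y)²` with `x = (q² - p²) Δ²` and `y = 0.4 m²`; this is where 1.6 =
  -- 4 · 0.4 enters. The term `x` is exactly the drift that cancels against `d`.
  have c : w * Δ ≤ (q ^ 2 - p ^ 2) * Δ ^ 2 + 0.4 * m ^ 2 := by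
    have h0 : 0 ≤ (q ^ 2 - p ^ 2) * Δ ^ 2 := mul_nonneg (by linarith) (sq_nonneg _)
    refine abs_le_of_sq_le_sq' ?_ (by positivity) |>.2
    rw [mul_pow, hw2]
    nlinarith [sq_nonneg ((q ^ 2 - p ^ 2) * Δ ^ 2 - 0.4 * m ^ 2)]
  have d : (q ^ 2 - p ^ 2) * Δ + 1.4 * (m * p) - q ^ 2 * (Δ / 100) ≤ w := by
    nlinarith [mul_le_mul_of_nonneg_left hε (sq_nonneg p),
      mul_le_mul_of_nonneg_left hε (sq_nonneg q), mul_le_mul_of_nonneg_right hst hΔ.le]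
  have e : 1.4 * (m * (p * Δ)) ≤ 0.4 * m ^ 2 + (q * Δ) ^ 2 / 100 := by
    nlinarith [mul_le_mul_of_nonneg_right d hΔ.le]
  have f : (q * Δ) ^ 2 ≤ 1.12 * m ^ 2 := by
    have : q * Δ ≤ 1.056 * m := by linarith
    nlinarith [mul_pos hq hΔ]
  have g' : 0.348 * m ^ 2 ≤ m * (p * Δ) := by
    have : 0.348 * m ≤ p * Δ := by linarith
    nlinarith
  -- The left side of `e` is at least `1.4 · 0.348 m² > 0.487 m²`, its right side at most `(0.4 +
  -- 0.0112) m²`.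
  nlinarith

/-- A pull of a suboptimal arm at low load, under noise within the exploration radius, happens
only while the arm has been pulled few times. -/
theorem low_load_count_le {K : ℕ} {α : ℝ} (hα : 0 ≤ α) {a : ℕ → Fin K} {y : Fin K → ℕ → ℝ}
    {u : Fin K → ℝ} {kstar : Fin K} (hbest : ∀ k, k ≠ kstar → u k < u kstar) {n : ℕ}
    (hpos : ∀ k, 1 ≤ armCount a k n)
    (hmax : ∀ k, u k + noiseSum a y k n / armCount a k n + √(α * Real.log (n + 1) / armCount a k n)
      ≤ u (a n) + noiseSum a y (a n) n / armCount a (a n) n +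
        √(α * Real.log (n + 1) / armCount a (a n) n))
    (hnoise : ∀ k, |noiseSum a y k n| ≤ √(α * Real.log (n + 1) * armCount a k n))
    (hne : a n ≠ kstar) :
    (armCount a (a n) n : ℝ) ≤ 4 * α * Real.log (n + 1) / (u kstar - u (a n)) ^ 2 := by
  have hpos' : ∀ k, (0 : ℝ) < armCount a k n := fun k => by exact_mod_cast hpos k
  refine count_le_of_index_le (sub_pos.2 (hbest _ hne)) (hpos' kstar) (hpos' _)
    (mul_nonneg hα (Real.log_nonneg (by simp))) (hnoise kstar) (hnoise _) ?_
  linarith [hmax kstar]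

/-- At high load the best arm is pulled, if the noise is moderate and enough of the slots in the
second half of the past were at low load. -/
theorem high_load_pull_eq_best {K : ℕ} {α ρ : ℝ} (hα : 2 ≤ α) (hρ : 0 < ρ) {a : ℕ → Fin K}
    {y : Fin K → ℕ → ℝ} {u : Fin K → ℝ} {kstar : Fin K} (hbest : ∀ k, k ≠ kstar → u k < u kstar)
    {low : ℕ → Prop} [DecidablePred low] {t : ℕ}
    (hpos : ∀ n, K ≤ n → ∀ k, 1 ≤ armCount a k n)
    (hlow : ∀ n, K ≤ n → low n → ∀ k,
      u k + noiseSum a y k n / armCount a k n + √(α * Real.log (n + 1) / armCount a k n)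
      ≤ u (a n) + noiseSum a y (a n) n / armCount a (a n) n +
        √(α * Real.log (n + 1) / armCount a (a n) n))
    (hhigh : ∀ k, u k + noiseSum a y k t / armCount a k t
      ≤ u (a t) + noiseSum a y (a t) t / armCount a (a t) t)
    (hnoise : ∀ k, ∀ n ≤ t, |noiseSum a y k n| ≤ 1.05 * √(Real.log (t + 1) * armCount a k n))
    (hincr : ∀ k, ∀ n ≤ t, noiseSum a y k t - noiseSum a y k n ≤
      √(1.6 * ((armCount a k t : ℝ) - armCount a k n) * Real.log (t + 1)))
    (hcard : ρ * t / 4 ≤ ((Finset.Ico (t / 2) t).filter low).card)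
    (hK : 0 < t / 2) (hKt : K ≤ t / 2)
    (hlog : 1.96 * Real.log (t + 1) ≤ α * Real.log ((t / 2 : ℕ) + 1))
    (hsum : ∑ k ∈ Finset.univ.erase kstar, (4 * α * Real.log (t + 1) / (u kstar - u k) ^ 2 + 1) +
      (ρ * t / 16 + 1) ≤ ρ * t / 4)
    (heps : ∀ k, k ≠ kstar →
      (1.05 + √α) * √(Real.log (t + 1) / (ρ * t / 16)) ≤ (u kstar - u k) / 200) :
    a t = kstar := by
  by_contra hne
  have ht : 0 < t := by omega
  have ht' : (0 : ℝ) < t := by exact_mod_cast ht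
  set r := Real.log (t + 1) with hr
  have hr0 : 0 < r := Real.log_pos (by linarith)
  -- Note 1.96 = 1.4²: throughout the window the bonus of an arm with count `N` is at least `1.4 √(r
  -- / N)`, which beats the noise level 1.05 by a margin.
  have hlogn : ∀ n : ℕ, t / 2 ≤ n → 1.96 * r ≤ α * Real.log (n + 1) := by
    intro n hn
    refine hlog.trans (mul_le_mul_of_nonneg_left (Real.log_le_log (by positivity) ?_)
      (by linarith))
    have : ((t / 2 : ℕ) : ℝ) ≤ n := by exact_mod_cast hn
    linarith
  have hlogn' : ∀ n : ℕ, n ≤ t → Real.log (n + 1) ≤ r := by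
    intro n hn
    have : (n : ℝ) ≤ t := by exact_mod_cast hn
    exact Real.log_le_log (by positivity) (by linarith)
  -- Pulls of suboptimal arms at low load are few in the window.
  have hfew : ∀ k ∈ Finset.univ.erase kstar,
      (((Finset.Ico (t / 2) t).filter fun n => low n ∧ a n = k).card : ℝ) ≤
        4 * α * r / (u kstar - u k) ^ 2 + 1 := by
    intro k hk
    have hk' : k ≠ kstar := Finset.ne_of_mem_erase hk
    refine card_le_of_armCount_le a k (by positivity) fun n hn => ?_
    simp only [Finset.mem_filter, Finset.mem_Ico] at hn
    obtain ⟨⟨hn₁, hn₂⟩, hn₃, rfl⟩ := hn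
    refine ⟨rfl, (low_load_count_le (by linarith) hbest (hpos n (by omega))
      (hlow n (by omega) hn₃) (fun k => ?_) hk').trans ?_⟩
    · refine (hnoise k n hn₂.le).trans ?_
      refine Real.le_sqrt_of_sq_le ?_
      rw [mul_pow, Real.sq_sqrt (by positivity), ← mul_assoc]
      refine mul_le_mul_of_nonneg_right ?_ (by positivity)
      linarith [hlogn n hn₁]
    · have := hlogn' n hn₂.le
      gcongr
  set W := (Finset.Ico (t / 2) t).filter fun n => low n ∧ a n = kstar with hW
  have hWcard : ρ * t / 16 + 1 ≤ W.card := by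
    have h : ((Finset.Ico (t / 2) t).filter low).card =
        ∑ k, ((Finset.Ico (t / 2) t).filter fun n => low n ∧ a n = k).card := by
      rw [Finset.card_eq_sum_card_fiberwise (f := a) (t := Finset.univ) (by simp)]
      simp only [Finset.filter_filter]
    rw [← Finset.add_sum_erase _ _ (Finset.mem_univ kstar)] at h
    rw [h] at hcard
    push_cast at hcard
    linarith [Finset.sum_le_sum hfew]
  have hWne : W.Nonempty := by
    rw [← Finset.card_pos]
    have : (0 : ℝ) < W.card := by linarith [show 0 ≤ ρ * t / 16 by positivity]
    exact_mod_cast this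
  -- The last pull of the best arm at low load in the window: all the others precede it, so the
  -- count of the best arm is already linear in `t` at time `τ`.
  obtain ⟨τ, hτ, hτmax⟩ : ∃ τ ∈ W, ∀ n ∈ W, n ≤ τ := ⟨W.max' hWne, W.max'_mem hWne, W.le_max'⟩
  have hτ' := hτ
  simp only [hW, Finset.mem_filter, Finset.mem_Ico] at hτ'
  obtain ⟨⟨hτ₁, hτ₂⟩, hτlow, hτa⟩ := hτ'
  have hNτ : ρ * t / 16 ≤ armCount a kstar τ := by
    have h := card_le_armCount a (k := kstar) (s := W.erase τ) (n := τ) fun n hn =>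
      ⟨lt_of_le_of_ne (hτmax n (Finset.mem_of_mem_erase hn)) (Finset.ne_of_mem_erase hn),
        (Finset.mem_filter.1 (Finset.mem_of_mem_erase hn)).2.2⟩
    rw [Finset.card_erase_of_mem hτ] at h
    have h' : W.card ≤ armCount a kstar τ + 1 := by omega
    have h'' : (W.card : ℝ) ≤ armCount a kstar τ + 1 := by exact_mod_cast h'
    linarith
  have hNt : ρ * t / 16 ≤ armCount a kstar t :=
    hNτ.trans (by exact_mod_cast armCount_mono a kstar hτ₂.le)
  set b := √(r / (ρ * t / 16)) with hb
  have hb0 : 0 ≤ b := Real.sqrt_nonneg _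
  have hsqrt : ∀ n ≤ t, ρ * t / 16 ≤ armCount a kstar n →
      |noiseSum a y kstar n / armCount a kstar n| ≤ 1.05 * b ∧
      √(α * Real.log (n + 1) / armCount a kstar n) ≤ √α * b := by
    intro n hn hN
    have hM : 0 < ρ * t / 16 := by positivity
    have hN0 : (0 : ℝ) < armCount a kstar n := hM.trans_le hN
    constructor
    · rw [abs_div, abs_of_pos hN0, div_le_iff₀ hN0]
      refine (hnoise kstar n hn).trans ?_
      rw [mul_assoc]
      refine mul_le_mul_of_nonneg_left (Real.sqrt_le_iff.2 ⟨by positivity, ?_⟩) (by norm_num)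
      rw [mul_pow, Real.sq_sqrt (by positivity), pow_two, ← mul_assoc]
      refine mul_le_mul_of_nonneg_right ?_ hN0.le
      rw [div_mul_eq_mul_div, le_div_iff₀ hM]
      exact mul_le_mul_of_nonneg_left hN hr0.le
    · rw [← Real.sqrt_mul (by linarith), mul_div_assoc]
      refine Real.sqrt_le_sqrt (mul_le_mul_of_nonneg_left ?_ (by linarith))
      exact div_le_div₀ hr0.le (hlogn' n hn) hM hN
  obtain ⟨hSτ, hBτ⟩ := hsqrt τ hτ₂.le hNτ
  obtain ⟨hSt, -⟩ := hsqrt t le_rfl hNt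
  set k := a t with hk
  have hsτ : (0 : ℝ) < armCount a k τ := by exact_mod_cast hpos τ (by omega) k
  have hst : (armCount a k τ : ℝ) ≤ armCount a k t := by
    exact_mod_cast armCount_mono a k hτ₂.le
  -- The error `ε` is `(1.05 + √α) b`: the noise of the best arm's mean plus its bonus at time `τ`.
  refine false_of_noise_excursion (S := noiseSum a y k τ) (T := noiseSum a y k t) hr0 hsτ hst
    (sub_pos.2 (hbest k hne)) (heps k hne) ?_ ?_ (hnoise k τ hτ₂.le) (hnoise k t le_rfl)
    (hincr k τ hτ₂.le)
  · have h := hlow τ (by omega) hτlow k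
    rw [hτa] at h
    have h2 : 1.4 * √(r * armCount a k τ) ≤
        armCount a k τ * √(α * Real.log (τ + 1) / armCount a k τ) := by
      have e : (armCount a k τ : ℝ) * √(α * Real.log (τ + 1) / armCount a k τ) =
          √(α * Real.log (τ + 1) * armCount a k τ) := by
        rw [← Real.sqrt_sq hsτ.le, ← Real.sqrt_mul (sq_nonneg _), Real.sqrt_sq hsτ.le]
        congr 1
        field_simp
      rw [e]
      refine Real.le_sqrt_of_sq_le ?_
      rw [mul_pow, Real.sq_sqrt (by positivity), ← mul_assoc]
      refine mul_le_mul_of_nonneg_right ?_ hsτ.le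
      linarith [hlogn τ hτ₁]
    have h3 : noiseSum a y k τ = armCount a k τ * (noiseSum a y k τ / armCount a k τ) := by
      field_simp
    calc noiseSum a y k τ + 1.4 * √(r * armCount a k τ)
        ≤ armCount a k τ * (noiseSum a y k τ / armCount a k τ +
            √(α * Real.log (τ + 1) / armCount a k τ)) := by rw [mul_add, ← h3]; linarith
      _ ≤ _ := by
        refine mul_le_mul_of_nonneg_left ?_ hsτ.le
        linarith [le_of_abs_le hSτ]
  -- Without bonuses only the noise of the best arm's mean, at most `1.05 b`, separates the two
  -- sides.
  · have h := hhigh kstar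
    rw [mul_comm, ← le_div_iff₀ (hsτ.trans_le hst)]
    nlinarith [neg_le_of_abs_le hSt, Real.sqrt_nonneg α]


/-! ### Concentration for predictable subsets of independent variables. -/

theorem integral_mul_of_indep {Ω : Type*} {m₁ m₂ m : MeasurableSpace Ω} {P : Measure Ω}
    (h₁ : m₁ ≤ m) (h₂ : m₂ ≤ m) (h : Indep m₁ m₂ P) {F G : Ω → ℝ} (hF : Measurable[m₁] F)
    (hG : Measurable[m₂] G) : ∫ ω, F ω * G ω ∂P = (∫ ω, F ω ∂P) * ∫ ω, G ω ∂P := by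
  have hind : IndepFun F G P := (IndepFun_iff_Indep F G P).2
    (indep_of_indep_of_le_left (indep_of_indep_of_le_right h hG.comap_le) hF.comap_le)
  exact hind.integral_fun_mul_eq_mul_integral (hF.mono h₁ le_rfl).aestronglyMeasurable
    (hG.mono h₂ le_rfl).aestronglyMeasurable

section Predictable

variable {Ω : Type*} {m : MeasurableSpace Ω} {P : Measure Ω} [IsProbabilityMeasure P]

/-- The exponential supermartingale of a sum of independent sub-Gaussian variables, of which a
predictable subset is taken. -/
theorem integral_exp_predictable_le_one {𝓕 : ℕ → MeasurableSpace Ω} (h𝓕 : ∀ n, 𝓕 n ≤ m)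
    {Y : ℕ → Ω → ℝ} {A : ℕ → Set Ω} (hYm : ∀ n, Measurable (Y n))
    (hY : ∀ n, ∀ i < n, Measurable[𝓕 n] (Y i))
    (hA : ∀ n, ∀ i ≤ n, MeasurableSet[𝓕 n] (A i))
    (hsub : ∀ n, HasSubgaussianMGF (Y n) (1 / 4) P)
    (hind : ∀ n, Indep (MeasurableSpace.comap (Y n) inferInstance) (𝓕 n) P) (c : ℝ) (n : ℕ) :
    Integrable (fun ω => Real.exp (∑ i ∈ Finset.range n,
      (A i).indicator (fun ω => c * Y i ω - c ^ 2 / 8) ω)) P ∧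
    ∫ ω, Real.exp (∑ i ∈ Finset.range n,
      (A i).indicator (fun ω => c * Y i ω - c ^ 2 / 8) ω) ∂P ≤ 1 := by
  induction n with
  | zero => simp
  | succ n ih =>
    set M : Ω → ℝ := fun ω => Real.exp (∑ i ∈ Finset.range n,
      (A i).indicator (fun ω => c * Y i ω - c ^ 2 / 8) ω) with hM
    -- The new factor minus one: the process changes only on `A n`, by `M * E`, and `E` is
    -- independent of the past with nonpositive mean by the sub-Gaussian bound.
    set E : Ω → ℝ := fun ω => Real.exp (c * Y n ω - c ^ 2 / 8) - 1 with hE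
    have hMm : Measurable[𝓕 n] M := by
      refine Real.measurable_exp.comp (Finset.measurable_sum _ fun i hi => ?_)
      have hi' := Finset.mem_range.1 hi
      exact (((hY n i hi').const_mul c).sub_const _).indicator (hA n i hi'.le)
    have hFm : Measurable[𝓕 n] ((A n).indicator M) := hMm.indicator (hA n n le_rfl)
    have hEm : Measurable[MeasurableSpace.comap (Y n) inferInstance] E := by
      have : Measurable fun y : ℝ => Real.exp (c * y - c ^ 2 / 8) - 1 := by fun_prop
      exact this.comp (comap_measurable (Y n))
    have hFi : Integrable ((A n).indicator M) P :=
      ih.1.indicator (h𝓕 n _ (hA n n le_rfl))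
    have hE1 : Integrable (fun ω => Real.exp (c * Y n ω - c ^ 2 / 8)) P := by
      simp_rw [sub_eq_add_neg, Real.exp_add]
      exact ((hsub n).integrable_exp_mul c).mul_const _
    have hEi : Integrable E P := hE1.sub (integrable_const 1)
    have hEle : ∫ ω, E ω ∂P ≤ 0 := by
      have h1 : ∫ ω, Real.exp (c * Y n ω - c ^ 2 / 8) ∂P ≤ 1 := by
        simp_rw [sub_eq_add_neg, Real.exp_add]
        rw [integral_mul_const]
        have h := (hsub n).mgf_le c
        rw [mgf] at h
        calc _ ≤ Real.exp (((1 / 4 : NNReal) : ℝ) * c ^ 2 / 2) * Real.exp (-(c ^ 2 / 8)) :=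
              mul_le_mul_of_nonneg_right h (Real.exp_pos _).le
          _ = 1 := by
              rw [← Real.exp_add]
              push_cast
              ring_nf
              exact Real.exp_zero
      rw [hE, integral_sub hE1 (integrable_const 1)]
      simpa using h1
    have hprod : ∫ ω, (A n).indicator M ω * E ω ∂P =
        (∫ ω, (A n).indicator M ω ∂P) * ∫ ω, E ω ∂P :=
      integral_mul_of_indep (h𝓕 n) (hYm n).comap_le (hind n).symm hFm hEm
    have hprodi : Integrable (fun ω => (A n).indicator M ω * E ω) P := by
      have hi : IndepFun ((A n).indicator M) E P := (IndepFun_iff_Indep _ _ P).2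
        (indep_of_indep_of_le_left (indep_of_indep_of_le_right (hind n).symm hEm.comap_le)
          hFm.comap_le)
      exact hi.integrable_mul hFi hEi
    have hstep : (fun ω => Real.exp (∑ i ∈ Finset.range (n + 1),
        (A i).indicator (fun ω => c * Y i ω - c ^ 2 / 8) ω)) =
        fun ω => M ω + (A n).indicator M ω * E ω := by
      funext ω
      rw [Finset.sum_range_succ, Real.exp_add]
      by_cases h : ω ∈ A n
      · simp only [Set.indicator_of_mem h, hM, hE]; ring
      · simp [Set.indicator_of_notMem h, hM]
    rw [hstep]
    refine ⟨ih.1.add hprodi, ?_⟩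
    rw [integral_add ih.1 hprodi, hprod]
    have h0 : 0 ≤ ∫ ω, (A n).indicator M ω ∂P :=
      integral_nonneg fun ω => Set.indicator_nonneg (fun _ _ => (Real.exp_pos _).le) ω
    nlinarith [ih.2]

/-- Hoeffding's inequality for a predictable subset of fixed size `d`. -/
theorem measure_predictable_sum_ge_le {𝓕 : ℕ → MeasurableSpace Ω} (h𝓕 : ∀ n, 𝓕 n ≤ m)
    {Y : ℕ → Ω → ℝ} {A : ℕ → Set Ω} (hYm : ∀ n, Measurable (Y n))
    (hY : ∀ n, ∀ i < n, Measurable[𝓕 n] (Y i))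
    (hA : ∀ n, ∀ i ≤ n, MeasurableSet[𝓕 n] (A i))
    (hsub : ∀ n, HasSubgaussianMGF (Y n) (1 / 4) P)
    (hind : ∀ n, Indep (MeasurableSpace.comap (Y n) inferInstance) (𝓕 n) P)
    (n : ℕ) {d b : ℝ} (hd : 0 < d) (hb : 0 ≤ b) :
    P.real {ω | ∑ i ∈ Finset.range n, (A i).indicator (fun _ => (1 : ℝ)) ω = d ∧
      √(b * d) ≤ ∑ i ∈ Finset.range n, (A i).indicator (Y i) ω} ≤ Real.exp (-(2 * b)) := by
  -- The maximizer of `c √(b d) - c² d / 8`, with maximum `2 b`. Since the size `d` is fixed, `c` is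
  -- deterministic.
  set c := 4 * √(b * d) / d with hc
  have hc0 : 0 ≤ c := by positivity
  obtain ⟨hi, hle⟩ := integral_exp_predictable_le_one h𝓕 hYm hY hA hsub hind c n
  have hmark := mul_meas_ge_le_integral_of_nonneg (Filter.Eventually.of_forall fun ω =>
    (Real.exp_pos _).le) hi (Real.exp (2 * b))
  have hsubset : {ω | ∑ i ∈ Finset.range n, (A i).indicator (fun _ => (1 : ℝ)) ω = d ∧
      √(b * d) ≤ ∑ i ∈ Finset.range n, (A i).indicator (Y i) ω} ⊆
      {ω | Real.exp (2 * b) ≤ Real.exp (∑ i ∈ Finset.range n,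
        (A i).indicator (fun ω => c * Y i ω - c ^ 2 / 8) ω)} := by
    rintro ω ⟨h1, h2⟩
    refine Real.exp_le_exp.2 ?_
    have e : ∑ i ∈ Finset.range n, (A i).indicator (fun ω => c * Y i ω - c ^ 2 / 8) ω =
        c * ∑ i ∈ Finset.range n, (A i).indicator (Y i) ω -
          c ^ 2 / 8 * ∑ i ∈ Finset.range n, (A i).indicator (fun _ => (1 : ℝ)) ω := by
      rw [Finset.mul_sum, Finset.mul_sum, ← Finset.sum_sub_distrib]
      refine Finset.sum_congr rfl fun i _ => ?_
      by_cases h : ω ∈ A i <;> simp [h]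
    rw [e, h1]
    have e2 : 2 * b = c * √(b * d) - c ^ 2 / 8 * d := by
      have hs := Real.mul_self_sqrt (mul_nonneg hb hd.le)
      rw [hc]
      field_simp
      nlinarith
    rw [e2]
    exact sub_le_sub_right (mul_le_mul_of_nonneg_left h2 hc0) _
  have h := measureReal_mono (μ := P) hsubset
  rw [Real.exp_neg, ← one_div, le_div_iff₀ (Real.exp_pos _)]
  nlinarith [Real.exp_pos (2 * b)]

end Predictable

/-! ### Independence and measurability in the stochastic model. -/

section Model

variable {K : ℕ} {Ω : Type*} {L : ℕ → Ω → ℝ} {X : Fin K → ℕ → Ω → ℝ} {u : Fin K → ℝ}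

/-- The loads and the rewards as one family. -/
def source (L : ℕ → Ω → ℝ) (X : Fin K → ℕ → Ω → ℝ) : ℕ ⊕ (Fin K × ℕ) → Ω → ℝ :=
  Sum.elim L fun i => X i.1 i.2

/-- The information in a subfamily of the loads and rewards. -/
abbrev sourceAlgebra (L : ℕ → Ω → ℝ) (X : Fin K → ℕ → Ω → ℝ) (S : Set (ℕ ⊕ (Fin K × ℕ))) :
    MeasurableSpace Ω :=
  ⨆ i ∈ S, MeasurableSpace.comap (source L X i) inferInstance

/-- All loads, and the rewards before slot `n`. -/
def pastRewards (K n : ℕ) : Set (ℕ ⊕ (Fin K × ℕ)) := {i | ∀ p, i = Sum.inr p → p.2 < n}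

/-- All rewards, and the loads before slot `n`. -/
def pastLoads (K n : ℕ) : Set (ℕ ⊕ (Fin K × ℕ)) := {i | ∀ m, i = Sum.inl m → m < n}

theorem IsModel.iIndepFun_source [MeasurableSpace Ω] {P : Measure Ω}
    (h : IsModel P L X u) : iIndepFun (source L X) P := by
  rw [iIndepFun_iff_measure_inter_preimage_eq_mul]
  intro S sets hS
  have hL := h.indep_load.measure_inter_preimage_eq_mul S.toLeft
    (sets := fun i => sets (Sum.inl i)) fun i hi => hS _ (Finset.mem_toLeft.1 hi)
  have hX := h.indep_reward.measure_inter_preimage_eq_mul S.toRight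
    (sets := fun i => sets (Sum.inr i)) fun i hi => hS _ (Finset.mem_toRight.1 hi)
  rw [Finset.prod_sum_eq_prod_toLeft_mul_prod_toRight]
  have hLX := h.indep_load_reward.measure_inter_preimage_eq_mul
    (⋂ i ∈ S.toLeft, (fun f : ℕ → ℝ => f i) ⁻¹' sets (Sum.inl i))
    (⋂ i ∈ S.toRight, (fun f : Fin K × ℕ → ℝ => f i) ⁻¹' sets (Sum.inr i))
    (Finset.measurableSet_biInter _ fun i hi =>
      measurable_pi_apply i (hS _ (Finset.mem_toLeft.1 hi)))
    (Finset.measurableSet_biInter _ fun i hi =>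
      measurable_pi_apply i (hS _ (Finset.mem_toRight.1 hi)))
  simp only [Set.preimage_iInter, ← Set.preimage_comp] at hLX
  convert hLX using 1
  · congr 1
    ext ω
    simp only [Set.mem_iInter, Set.mem_inter_iff, Finset.mem_toLeft, Finset.mem_toRight,
      Sum.forall]
    rfl
  · exact congrArg₂ _ hL.symm hX.symm

theorem IsModel.measurable_source [MeasurableSpace Ω] {P : Measure Ω}
    (h : IsModel P L X u) (i : ℕ ⊕ (Fin K × ℕ)) :
    Measurable (source L X i) := by
  rcases i with n | ⟨k, n⟩
  · exact h.measurable_load n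
  · exact h.measurable_reward k n

theorem IsModel.sourceAlgebra_le [MeasurableSpace Ω] {P : Measure Ω}
    (h : IsModel P L X u) (S : Set (ℕ ⊕ (Fin K × ℕ))) :
    sourceAlgebra L X S ≤ ‹MeasurableSpace Ω› :=
  iSup₂_le fun i _ => (h.measurable_source i).comap_le

theorem measurable_source_sourceAlgebra (L : ℕ → Ω → ℝ) (X : Fin K → ℕ → Ω → ℝ)
    {S : Set (ℕ ⊕ (Fin K × ℕ))} {i} (hi : i ∈ S) :
    Measurable[sourceAlgebra L X S] (source L X i) :=
  (comap_measurable _).mono (le_iSup₂ (f := fun i (_ : i ∈ S) =>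
    MeasurableSpace.comap (source L X i) inferInstance) i hi) le_rfl

theorem IsModel.indep_sourceAlgebra [MeasurableSpace Ω] {P : Measure Ω}
    (h : IsModel P L X u) {S T : Set (ℕ ⊕ (Fin K × ℕ))}
    (hST : Disjoint S T) : Indep (sourceAlgebra L X S) (sourceAlgebra L X T) P :=
  indep_iSup_of_disjoint (fun i => (h.measurable_source i).comap_le) h.iIndepFun_source.iIndep hST

/-- The σ-algebra is left arbitrary so that the lemma serves for `pastRewards`, for `pastLoads` and
for the ambient one. -/
theorem measurable_history {Γ : Policy K} (m : MeasurableSpace Ω)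
    (hΓ : ∀ n, Measurable fun p : History K n × ℝ => Γ n p.1 p.2) {n : ℕ}
    (hL : ∀ i < n, Measurable (L i)) (hX : ∀ k, ∀ i < n, Measurable (X k i)) :
    Measurable fun ω => history Γ (fun i => L i ω) (fun k i => X k i ω) n := by
  induction n with
  | zero => exact measurable_const
  | succ n ih =>
    have hh := ih (fun i hi => hL i (hi.trans n.lt_succ_self))
      fun k i hi => hX k i (hi.trans n.lt_succ_self)
    have ha : Measurable fun ω => Γ n (history Γ (fun i => L i ω) (fun k i => X k i ω) n) (L n ω) :=
      (hΓ n).comp (hh.prodMk (hL n n.lt_succ_self))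
    have hr : Measurable fun ω =>
        X (Γ n (history Γ (fun i => L i ω) (fun k i => X k i ω) n) (L n ω)) n ω := by
      have h := measurable_from_prod_countable_right (f := fun p : Fin K × Ω => X p.1 n p.2)
        fun k => hX k n n.lt_succ_self
      exact h.comp (ha.prodMk measurable_id)
    refine measurable_pi_iff.2 fun i => ?_
    refine Fin.lastCases ?_ (fun j => ?_) i
    · simpa [history] using (hL n n.lt_succ_self).prodMk (ha.prodMk hr)
    · simpa [history] using measurable_pi_iff.1 hh j

theorem measurable_pulledArm {Γ : Policy K} (m : MeasurableSpace Ω)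
    (hΓ : ∀ n, Measurable fun p : History K n × ℝ => Γ n p.1 p.2) {n : ℕ}
    (hL : ∀ i ≤ n, Measurable (L i)) (hX : ∀ k, ∀ i < n, Measurable (X k i)) :
    Measurable fun ω => pulledArm Γ (fun i => L i ω) (fun k i => X k i ω) n :=
  (hΓ n).comp ((measurable_history m hΓ (fun i hi => hL i hi.le) hX).prodMk (hL n le_rfl))

end Model


/-! ### Probability of immoderate noise and of too few low-load slots. -/

section Tail

variable {K : ℕ} {Ω : Type*} {L : ℕ → Ω → ℝ} {X : Fin K → ℕ → Ω → ℝ} {u : Fin K → ℝ}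

/-- The sequence of pulled arms, as a function of the outcome. -/
def armSeq (Γ : Policy K) (L : ℕ → Ω → ℝ) (X : Fin K → ℕ → Ω → ℝ) (ω : Ω) : ℕ → Fin K :=
  pulledArm Γ (fun i => L i ω) (fun k i => X k i ω)

/-- The noise of the rewards, as a function of the outcome. -/
def noise (X : Fin K → ℕ → Ω → ℝ) (u : Fin K → ℝ) (ω : Ω) : Fin K → ℕ → ℝ :=
  fun k i => X k i ω - u k

theorem measurable_armSeq_pastRewards {Γ : Policy K}
    (hΓ : ∀ n, Measurable fun p : History K n × ℝ => Γ n p.1 p.2) {i n : ℕ} (hin : i ≤ n) :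
    Measurable[sourceAlgebra L X (pastRewards K n)] fun ω => armSeq Γ L X ω i :=
  measurable_pulledArm _ hΓ
    (fun j _ => measurable_source_sourceAlgebra L X (i := Sum.inl j) (by simp [pastRewards]))
    fun k j hj => measurable_source_sourceAlgebra L X (i := Sum.inr (k, j))
      (by simp [pastRewards]; omega)

theorem measurable_armCount {Γ : Policy K} (m : MeasurableSpace Ω) {n : ℕ}
    (ha : ∀ i < n, Measurable[m] fun ω => armSeq Γ L X ω i) (k : Fin K) :
    Measurable[m] fun ω => armCount (armSeq Γ L X ω) k n := by
  simp only [armCount, Finset.card_filter]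
  refine Finset.measurable_sum _ fun i hi => ?_
  exact Measurable.ite (ha i (Finset.mem_range.1 hi) (measurableSet_singleton k))
    measurable_const measurable_const

/-- The past may include all loads, even the current and future ones, because the rewards are
independent of them. The arm pulled in slot `n` thus belongs to this past. -/
theorem IsModel.indep_reward_past [MeasurableSpace Ω] {P : Measure Ω}
    (h : IsModel P L X u) (k : Fin K) (n : ℕ) :
    Indep (MeasurableSpace.comap (X k n) inferInstance)
      (sourceAlgebra L X (pastRewards K n)) P := by
  refine indep_of_indep_of_le_left
    (h.indep_sourceAlgebra (S := {Sum.inr (k, n)}) (T := pastRewards K n) ?_) ?_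
  · exact Set.disjoint_singleton_left.2 fun hk => lt_irrefl n (hk _ rfl)
  · exact (measurable_source_sourceAlgebra L X (i := Sum.inr (k, n)) (Set.mem_singleton _)).comap_le

theorem IsModel.hasSubgaussianMGF_noise [MeasurableSpace Ω] {P : Measure Ω}
    [IsProbabilityMeasure P] (h : IsModel P L X u) (k : Fin K) (n : ℕ) :
    HasSubgaussianMGF (fun ω => X k n ω - u k) (1 / 4) P := by
  have := hasSubgaussianMGF_of_mem_Icc (h.measurable_reward k n).aemeasurable
    (Filter.Eventually.of_forall (h.reward_mem k n) : ∀ᵐ ω ∂P, _)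
  rw [h.mean_reward] at this
  convert this using 1
  norm_num

/-- The event that the pulls of arm `k` from the `s₁`-st to the `s₂`-nd all happen before slot `t`,
and their noise, multiplied by `σ`, exceeds its standard deviation by a factor of order `√b`. -/
def windowTail (Γ : Policy K) (L : ℕ → Ω → ℝ) (X : Fin K → ℕ → Ω → ℝ) (u : Fin K → ℝ) (k : Fin K)
    (t s₁ s₂ : ℕ) (σ b : ℝ) : Set Ω :=
  {ω | (∑ i ∈ Finset.range t, if armSeq Γ L X ω i = k ∧ s₁ ≤ armCount (armSeq Γ L X ω) k i ∧
      armCount (armSeq Γ L X ω) k i < s₂ then (1 : ℝ) else 0) = (s₂ : ℝ) - s₁ ∧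
    √(b * ((s₂ : ℝ) - s₁)) ≤ ∑ i ∈ Finset.range t, if armSeq Γ L X ω i = k ∧
      s₁ ≤ armCount (armSeq Γ L X ω) k i ∧ armCount (armSeq Γ L X ω) k i < s₂ then
      σ * noise X u ω k i else 0}

/-- Whether slot `i` falls in the window depends on the arm pulled there and on earlier pulls, hence
not on the reward of slot `i`; so Hoeffding for predictable subsets applies with `d = s₂ - s₁`. -/
theorem IsModel.measure_windowTail_le [MeasurableSpace Ω] {P : Measure Ω}
    [IsProbabilityMeasure P] (h : IsModel P L X u) {Γ : Policy K}
    (hΓ : ∀ n, Measurable fun p : History K n × ℝ => Γ n p.1 p.2) (k : Fin K) (t : ℕ) {s₁ s₂ : ℕ}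
    (hs : s₁ < s₂) {σ b : ℝ} (hσ : σ = 1 ∨ σ = -1) (hb : 0 ≤ b) :
    P.real (windowTail Γ L X u k t s₁ s₂ σ b) ≤ Real.exp (-(2 * b)) := by
  set A : ℕ → Set Ω := fun i => {ω | armSeq Γ L X ω i = k ∧
    s₁ ≤ armCount (armSeq Γ L X ω) k i ∧ armCount (armSeq Γ L X ω) k i < s₂} with hA
  set Y : ℕ → Ω → ℝ := fun i ω => σ * noise X u ω k i with hY
  have hYm : ∀ n (m : MeasurableSpace Ω), Measurable[m] (X k n) → Measurable[m] (Y n) :=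
    fun n m hm => (hm.sub_const _).const_mul σ
  have hd : (0 : ℝ) < (s₂ : ℝ) - s₁ := sub_pos.2 (by exact_mod_cast hs)
  have key := measure_predictable_sum_ge_le (P := P)
    (𝓕 := fun n => sourceAlgebra L X (pastRewards K n)) (Y := Y) (A := A)
    (fun n => h.sourceAlgebra_le _) (fun n => hYm n _ (h.measurable_reward k n))
    (fun n i hi => hYm i _ (measurable_source_sourceAlgebra L X (i := Sum.inr (k, i))
      (by simp [pastRewards]; omega)))
    (fun n i hi => ?_) (fun n => ?_) (fun n => ?_) t hd hb
  · refine le_trans (le_of_eq ?_) key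
    congr 1
    ext ω
    simp only [windowTail, Set.mem_ofPred_eq, Set.indicator_apply, hA, hY]
  · have ha : ∀ j ≤ i, Measurable[sourceAlgebra L X (pastRewards K n)]
        fun ω => armSeq Γ L X ω j :=
      fun j hj => measurable_armSeq_pastRewards hΓ (hj.trans hi)
    have hc := measurable_armCount _ (fun j hj => ha j hj.le) k
    exact MeasurableSet.inter (ha i le_rfl (measurableSet_singleton k))
      (MeasurableSet.inter (hc (measurableSet_Ici (a := s₁))) (hc (measurableSet_Iio (a := s₂))))
  · have hn := h.hasSubgaussianMGF_noise k n
    rcases hσ with rfl | rfl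
    · simpa [hY, noise] using hn
    · have := hn.neg
      convert this using 1
      funext ω
      simp [hY, noise]
  · exact indep_of_indep_of_le_left (h.indep_reward_past k n)
      (hYm n _ (comap_measurable (X k n))).comap_le

/-- The event that the noise is moderate up to slot `t`. -/
def moderateNoise (Γ : Policy K) (L : ℕ → Ω → ℝ) (X : Fin K → ℕ → Ω → ℝ) (u : Fin K → ℝ)
    (t : ℕ) : Set Ω :=
  {ω | (∀ k, ∀ n ≤ t, |noiseSum (armSeq Γ L X ω) (noise X u ω) k n| ≤
      1.05 * √(Real.log (t + 1) * armCount (armSeq Γ L X ω) k n)) ∧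
    ∀ k, ∀ n ≤ t, noiseSum (armSeq Γ L X ω) (noise X u ω) k t -
      noiseSum (armSeq Γ L X ω) (noise X u ω) k n ≤
      √(1.6 * ((armCount (armSeq Γ L X ω) k t : ℝ) - armCount (armSeq Γ L X ω) k n) *
        Real.log (t + 1))}

theorem mem_windowTail {Γ : Policy K} {k : Fin K} {n₁ n₂ t : ℕ} {σ b : ℝ} {ω : Ω} (h₁₂ : n₁ ≤ n₂)
    (h₂ : n₂ ≤ t)
    (h : √(b * ((armCount (armSeq Γ L X ω) k n₂ : ℝ) - armCount (armSeq Γ L X ω) k n₁)) ≤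
      σ * (noiseSum (armSeq Γ L X ω) (noise X u ω) k n₂ -
        noiseSum (armSeq Γ L X ω) (noise X u ω) k n₁)) :
    ω ∈ windowTail Γ L X u k t (armCount (armSeq Γ L X ω) k n₁)
      (armCount (armSeq Γ L X ω) k n₂) σ b := by
  refine ⟨?_, ?_⟩
  · rw [sum_window _ _ h₁₂ h₂]
    simp [armCount]
  · rw [sum_window _ _ h₁₂ h₂, ← Finset.mul_sum, ← Finset.mul_sum, ← mul_sub]
    exact h

/-- The counts at the times in question are random, so the union runs over all values they can take:
`2 t` events for windows that start at zero and `t²` for general ones. A window without pulls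
carries no noise and cannot violate a bound. -/
theorem compl_moderateNoise_subset (Γ : Policy K) (t : ℕ) :
    (moderateNoise Γ L X u t)ᶜ ⊆ ⋃ k : Fin K, (⋃ p ∈ Finset.range t,
      (windowTail Γ L X u k t 0 (p + 1) 1 (1.05 ^ 2 * Real.log (t + 1)) ∪
        windowTail Γ L X u k t 0 (p + 1) (-1) (1.05 ^ 2 * Real.log (t + 1)))) ∪
      ⋃ p ∈ Finset.range t ×ˢ Finset.range t,
        windowTail Γ L X u k t p.1 (p.1 + p.2 + 1) 1 (1.6 * Real.log (t + 1)) := by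
  have hr : 0 ≤ Real.log ((t : ℝ) + 1) := Real.log_nonneg (by simp)
  intro ω hω
  simp only [moderateNoise, Set.mem_compl_iff, Set.mem_ofPred_eq, not_and_or, not_forall,
    not_le] at hω
  rcases hω with ⟨k, n, hn, hω⟩ | ⟨k, n, hn, hω⟩
  · refine Set.mem_iUnion.2 ⟨k, Or.inl ?_⟩
    have h0 : noiseSum (armSeq Γ L X ω) (noise X u ω) k 0 = 0 := by simp [noiseSum]
    have c0 : armCount (armSeq Γ L X ω) k 0 = 0 := by simp [armCount]
    have hN : armCount (armSeq Γ L X ω) k n ≠ 0 := by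
      intro h
      have : noiseSum (armSeq Γ L X ω) (noise X u ω) k n = 0 := by
        rw [noiseSum, Finset.card_eq_zero.1 h, Finset.sum_empty]
      rw [this, h] at hω
      simp at hω
    obtain ⟨p, hp⟩ := Nat.exists_eq_succ_of_ne_zero hN
    have hpt : p < t := by
      have := armCount_le (armSeq Γ L X ω) k n
      omega
    have e : 1.05 * √(Real.log (t + 1) * armCount (armSeq Γ L X ω) k n) =
        √(1.05 ^ 2 * Real.log (t + 1) * armCount (armSeq Γ L X ω) k n) := by
      rw [mul_assoc, Real.sqrt_mul (show (0 : ℝ) ≤ 1.05 ^ 2 by norm_num),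
        Real.sqrt_sq (by norm_num)]
    rw [e] at hω
    refine Set.mem_iUnion₂.2 ⟨p, Finset.mem_range.2 hpt, ?_⟩
    have hm := fun σ => mem_windowTail (Γ := Γ) (X := X) (L := L) (u := u) (k := k) (σ := σ)
      (b := 1.05 ^ 2 * Real.log (t + 1)) (ω := ω) (Nat.zero_le n) hn
    simp only [c0, h0, sub_zero, Nat.cast_zero] at hm
    rw [← Nat.succ_eq_add_one, ← hp]
    rcases lt_abs.1 hω with h | h
    · exact Or.inl (hm 1 (by simpa using h.le))
    · exact Or.inr (hm (-1) (by simpa using h.le))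
  · refine Set.mem_iUnion.2 ⟨k, Or.inr ?_⟩
    have hle := armCount_mono (armSeq Γ L X ω) k hn
    have hne : armCount (armSeq Γ L X ω) k n ≠ armCount (armSeq Γ L X ω) k t := by
      intro h
      have hs : noiseSum (armSeq Γ L X ω) (noise X u ω) k n =
          noiseSum (armSeq Γ L X ω) (noise X u ω) k t := by
        rw [noiseSum, noiseSum, Finset.eq_of_subset_of_card_le
          (Finset.filter_subset_filter _ (Finset.range_mono hn)) h.symm.le]
      rw [hs, h] at hω
      simp at hω
    have htt := armCount_le (armSeq Γ L X ω) k t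
    -- A pair encodes a window by its start and its length minus one, which keeps windows nonempty
    -- and both entries below `t`.
    refine Set.mem_iUnion₂.2 ⟨(armCount (armSeq Γ L X ω) k n, armCount (armSeq Γ L X ω) k t -
      armCount (armSeq Γ L X ω) k n - 1), ?_, ?_⟩
    · simp only [Finset.mem_product, Finset.mem_range]
      omega
    · have e : armCount (armSeq Γ L X ω) k n + (armCount (armSeq Γ L X ω) k t -
          armCount (armSeq Γ L X ω) k n - 1) + 1 = armCount (armSeq Γ L X ω) k t := by omega
      simp only [e]
      refine mem_windowTail hn le_rfl ?_
      rw [one_mul, mul_right_comm]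
      exact hω.le

/-- The constants are chosen for summability: `t` windows at exponent `2 · 1.05² = 2.205` leave
`-1.205`, and `t²` windows at exponent `2 · 1.6 = 3.2` leave `-1.2`. -/
theorem IsModel.measure_compl_moderateNoise_le [MeasurableSpace Ω] {P : Measure Ω}
    [IsProbabilityMeasure P] (h : IsModel P L X u) {Γ : Policy K}
    (hΓ : ∀ n, Measurable fun p : History K n × ℝ => Γ n p.1 p.2) (t : ℕ) :
    P.real (moderateNoise Γ L X u t)ᶜ ≤ 3 * K * ((t : ℝ) + 1) ^ (-1.2 : ℝ) := by
  have ht : (1 : ℝ) ≤ t + 1 := by simp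
  have ht0 : (0 : ℝ) < t + 1 := by positivity
  have hr : 0 ≤ Real.log ((t : ℝ) + 1) := Real.log_nonneg ht
  have hexp : ∀ q : ℝ, Real.exp (-(2 * (q * Real.log (t + 1)))) = ((t : ℝ) + 1) ^ (-(2 * q)) := by
    intro q
    rw [Real.rpow_def_of_pos ht0]
    ring_nf
  have hb₁ : (0 : ℝ) ≤ 1.05 ^ 2 * Real.log (t + 1) := by positivity
  have hb₂ : (0 : ℝ) ≤ 1.6 * Real.log (t + 1) := by positivity
  have e₁ : (t : ℝ) * (2 * ((t : ℝ) + 1) ^ (-(2 * 1.05 ^ 2) : ℝ)) ≤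
      2 * ((t : ℝ) + 1) ^ (-1.2 : ℝ) := by
    calc (t : ℝ) * (2 * ((t : ℝ) + 1) ^ (-(2 * 1.05 ^ 2) : ℝ))
        ≤ ((t : ℝ) + 1) * (2 * ((t : ℝ) + 1) ^ (-(2 * 1.05 ^ 2) : ℝ)) := by gcongr; linarith
      _ = 2 * ((t : ℝ) + 1) ^ (1 + -(2 * 1.05 ^ 2) : ℝ) := by
          rw [Real.rpow_add ht0, Real.rpow_one]; ring
      _ ≤ _ := by gcongr; norm_num
  have e₂ : ((t : ℝ) * t) * ((t : ℝ) + 1) ^ (-(2 * 1.6) : ℝ) ≤ ((t : ℝ) + 1) ^ (-1.2 : ℝ) := by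
    calc ((t : ℝ) * t) * ((t : ℝ) + 1) ^ (-(2 * 1.6) : ℝ)
        ≤ (((t : ℝ) + 1) * ((t : ℝ) + 1)) * ((t : ℝ) + 1) ^ (-(2 * 1.6) : ℝ) := by
          gcongr <;> linarith
      _ = ((t : ℝ) + 1) ^ (1 + 1 + -(2 * 1.6) : ℝ) := by
          rw [Real.rpow_add ht0, Real.rpow_add ht0, Real.rpow_one]
      _ ≤ _ := by gcongr; norm_num
  refine (measureReal_mono (compl_moderateNoise_subset Γ t)).trans ?_
  refine (measureReal_iUnion_fintype_le _).trans ?_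
  have hk : ∀ k : Fin K, P.real ((⋃ p ∈ Finset.range t,
      (windowTail Γ L X u k t 0 (p + 1) 1 (1.05 ^ 2 * Real.log (t + 1)) ∪
        windowTail Γ L X u k t 0 (p + 1) (-1) (1.05 ^ 2 * Real.log (t + 1)))) ∪
      ⋃ p ∈ Finset.range t ×ˢ Finset.range t,
        windowTail Γ L X u k t p.1 (p.1 + p.2 + 1) 1 (1.6 * Real.log (t + 1))) ≤
      3 * ((t : ℝ) + 1) ^ (-1.2 : ℝ) := by
    intro k
    refine (measureReal_union_le _ _).trans ?_
    refine (add_le_add ((measureReal_biUnion_finset_le _ _).trans (Finset.sum_le_card_nsmul _ _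
      (2 * ((t : ℝ) + 1) ^ (-(2 * 1.05 ^ 2) : ℝ)) fun p hp => ?_))
      ((measureReal_biUnion_finset_le _ _).trans (Finset.sum_le_card_nsmul _ _
      (((t : ℝ) + 1) ^ (-(2 * 1.6) : ℝ)) fun p hp => ?_))).trans ?_
    · refine (measureReal_union_le _ _).trans ?_
      rw [two_mul (_ ^ _), ← hexp]
      exact add_le_add (h.measure_windowTail_le hΓ k t p.succ_pos (Or.inl rfl) hb₁)
        (h.measure_windowTail_le hΓ k t p.succ_pos (Or.inr rfl) hb₁)
    · rw [← hexp]
      exact h.measure_windowTail_le hΓ k t (by omega) (Or.inl rfl) hb₂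
    · simp only [Finset.card_range, Finset.card_product, nsmul_eq_mul, Nat.cast_mul]
      linarith
  refine (Finset.sum_le_sum fun k _ => hk k).trans (le_of_eq ?_)
  simp
  ring

/-- Hoeffding for at least `t / 2` independent indicators of mean `ρ`: the count must fall below
half of its mean, which is at least `ρ t / 4`. -/
theorem IsModel.measure_low_count_lt_le [MeasurableSpace Ω] {P : Measure Ω}
    [IsProbabilityMeasure P] (h : IsModel P L X u) {l ρ : ℝ} (hρ0 : 0 < ρ)
    (hρ : P.real {ω | L 0 ω ≤ l} = ρ) {t : ℕ} (ht : 0 < t) :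
    P.real {ω | (((Finset.Ico (t / 2) t).filter fun i => L i ω ≤ l).card : ℝ) < ρ * t / 4} ≤
      Real.exp (-(ρ ^ 2 / 4 * t)) := by
  -- The sign turns the lower tail of the count into an upper tail.
  set f : ℝ → ℝ := fun y => -(Set.Iic l).indicator (fun _ => (1 : ℝ)) y with hf
  have hfm : Measurable f := (measurable_const.indicator measurableSet_Iic).neg
  have hmean : ∀ n, ∫ ω, f (L n ω) ∂P = -ρ := by
    intro n
    have e : ∀ ω, (Set.Iic l).indicator (fun _ => (1 : ℝ)) (L n ω) =
        (L n ⁻¹' Set.Iic l).indicator 1 ω := fun ω => rfl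
    have hpre := (h.ident_load n).measure_mem_eq (measurableSet_Iic (a := l))
    simp only [hf, integral_neg, e]
    rw [integral_indicator_one (h.measurable_load n measurableSet_Iic), measureReal_def, hpre,
      ← hρ]
    rfl
  have hsub : ∀ n, HasSubgaussianMGF ((fun y => f y + ρ) ∘ L n) (1 / 4) P := by
    intro n
    have := hasSubgaussianMGF_of_mem_Icc (μ := P) (X := fun ω => f (L n ω)) (a := -1) (b := 0)
      (hfm.comp (h.measurable_load n)).aemeasurable (Filter.Eventually.of_forall fun ω => by
        simp only [hf, Set.indicator_apply]; split_ifs <;> norm_num)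
    rw [hmean] at this
    convert this using 1
    · funext ω; simp
    · norm_num
  have hind : iIndepFun (fun n => (fun y => f y + ρ) ∘ L n) P :=
    h.indep_load.comp _ fun _ => hfm.add_const ρ
  set m : ℕ := t - t / 2 with hm
  have hmt : (t : ℝ) / 2 ≤ m := by
    have : t ≤ 2 * m := by omega
    have : (t : ℝ) ≤ 2 * m := by exact_mod_cast this
    linarith
  have ht' : (0 : ℝ) < t := by exact_mod_cast ht
  have hH := HasSubgaussianMGF.measure_sum_ge_le_of_iIndepFun hind (s := Finset.Ico (t / 2) t)
    (fun i _ => hsub i) (ε := ρ * m / 2) (by positivity)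
  refine (measureReal_mono fun ω hω => ?_).trans (hH.trans (Real.exp_le_exp.2 ?_))
  · simp only [Set.mem_ofPred_eq] at hω ⊢
    have e : ∑ i ∈ Finset.Ico (t / 2) t, ((fun y => f y + ρ) ∘ L i) ω =
        ρ * m - (((Finset.Ico (t / 2) t).filter fun i => L i ω ≤ l).card : ℝ) := by
      simp only [Function.comp, Finset.sum_add_distrib, hf, Finset.sum_neg_distrib,
        Set.indicator_apply, Set.mem_Iic, Finset.sum_const, Nat.card_Ico, Finset.sum_boole,
        nsmul_eq_mul, hm]
      ring
    rw [e]
    nlinarith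
  · have hm0 : (0 : ℝ) < m := by linarith
    rw [Finset.sum_const, Nat.card_Ico, ← hm]
    have e : -(ρ * m / 2) ^ 2 / (2 * ((m • (1 / 4 : NNReal) : NNReal) : ℝ)) = -(ρ ^ 2 / 2 * m) := by
      rw [nsmul_eq_mul]
      push_cast
      field_simp
      ring
    rw [e]
    nlinarith [sq_nonneg ρ]

end Tail


/-! ### Index comparisons of the policy, and the time from which high load is safe. -/

section Policy

variable {K : ℕ} {Ω : Type*} {L : ℕ → Ω → ℝ} {X : Fin K → ℕ → Ω → ℝ} {u : Fin K → ℝ}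
  {α l : ℝ} {Γ : Policy K}

theorem adaIndex_of_le (hΓ : IsAdaUCB α l l Γ) {n : ℕ} (hn : K ≤ n) {ω : Ω} {y : ℝ} (hy : y ≤ l)
    (k : Fin K) :
    adaIndex α l l (history Γ (fun i => L i ω) (fun k i => X k i ω) n) y k =
      u k + noiseSum (armSeq Γ L X ω) (noise X u ω) k n / armCount (armSeq Γ L X ω) k n +
        √(α * Real.log (n + 1) / armCount (armSeq Γ L X ω) k n) := by
  rw [adaIndex, empiricalMean_history Γ _ _ u n k (one_le_armCount hΓ _ _ hn k),
    pullCount_history, normalizedLoad, if_pos rfl, if_pos hy, sub_zero, mul_one]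
  rfl

theorem adaIndex_of_lt (hΓ : IsAdaUCB α l l Γ) {n : ℕ} (hn : K ≤ n) {ω : Ω} {y : ℝ} (hy : l < y)
    (k : Fin K) :
    adaIndex α l l (history Γ (fun i => L i ω) (fun k i => X k i ω) n) y k =
      u k + noiseSum (armSeq Γ L X ω) (noise X u ω) k n / armCount (armSeq Γ L X ω) k n := by
  rw [adaIndex, empiricalMean_history Γ _ _ u n k (one_le_armCount hΓ _ _ hn k),
    normalizedLoad, if_pos rfl, if_neg hy.not_ge, sub_self, mul_zero, zero_mul, zero_div,
    Real.sqrt_zero, add_zero]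
  rfl

theorem index_le_of_low (hΓ : IsAdaUCB α l l Γ) {n : ℕ} (hn : K ≤ n) {ω : Ω} (hy : L n ω ≤ l)
    (k : Fin K) :
    u k + noiseSum (armSeq Γ L X ω) (noise X u ω) k n / armCount (armSeq Γ L X ω) k n +
        √(α * Real.log (n + 1) / armCount (armSeq Γ L X ω) k n) ≤
      u (armSeq Γ L X ω n) + noiseSum (armSeq Γ L X ω) (noise X u ω) (armSeq Γ L X ω n) n /
        armCount (armSeq Γ L X ω) (armSeq Γ L X ω n) n +
        √(α * Real.log (n + 1) / armCount (armSeq Γ L X ω) (armSeq Γ L X ω n) n) := by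
  rw [← adaIndex_of_le hΓ hn hy, ← adaIndex_of_le hΓ hn hy]
  exact hΓ.argmax n hn _ _ k

theorem index_le_of_high (hΓ : IsAdaUCB α l l Γ) {n : ℕ} (hn : K ≤ n) {ω : Ω} (hy : l < L n ω)
    (k : Fin K) :
    u k + noiseSum (armSeq Γ L X ω) (noise X u ω) k n / armCount (armSeq Γ L X ω) k n ≤
      u (armSeq Γ L X ω n) + noiseSum (armSeq Γ L X ω) (noise X u ω) (armSeq Γ L X ω n) n /
        armCount (armSeq Γ L X ω) (armSeq Γ L X ω n) n := by
  rw [← adaIndex_of_lt hΓ hn hy, ← adaIndex_of_lt hΓ hn hy]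
  exact hΓ.argmax n hn _ _ k

/-- Moderate noise lies within the exploration radius because `1.05² ≤ α`. -/
theorem armCount_le_of_moderateNoise (hα : 2 < α) (hΓ : IsAdaUCB α l l Γ) {kstar : Fin K}
    (hbest : ∀ k, k ≠ kstar → u k < u kstar) {n : ℕ} (hn : K ≤ n) {ω : Ω}
    (hω : ω ∈ moderateNoise Γ L X u n) (hy : L n ω ≤ l) (hne : armSeq Γ L X ω n ≠ kstar) :
    (armCount (armSeq Γ L X ω) (armSeq Γ L X ω n) n : ℝ) ≤
      4 * α * Real.log (n + 1) / (u kstar - u (armSeq Γ L X ω n)) ^ 2 := by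
  have hr : 0 ≤ Real.log ((n : ℝ) + 1) := Real.log_nonneg (by simp)
  refine low_load_count_le (by linarith) hbest (one_le_armCount hΓ _ _ hn)
    (index_le_of_low hΓ hn hy) (fun k => (hω.1 k n le_rfl).trans ?_) hne
  refine Real.le_sqrt_of_sq_le ?_
  rw [mul_pow, Real.sq_sqrt (by positivity), ← mul_assoc]
  exact mul_le_mul_of_nonneg_right (mul_le_mul_of_nonneg_right (by norm_num; linarith) hr)
    (by positivity)

/-- From a time that depends only on the parameters on, the best arm is pulled at high load,
if the noise is moderate and the slots at low load are not rare. -/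
theorem exists_high_load_pull_eq_best {α ρ : ℝ} (hα : 2 < α) (hρ : 0 < ρ) {kstar : Fin K}
    (hbest : ∀ k, k ≠ kstar → u k < u kstar) :
    ∃ t₀ : ℕ, ∀ t, t₀ ≤ t → 0 < t ∧ ∀ (Ω : Type*) (L : ℕ → Ω → ℝ) (X : Fin K → ℕ → Ω → ℝ) (l : ℝ)
      (Γ : Policy K), IsAdaUCB α l l Γ → ∀ ω ∈ moderateNoise Γ L X u t,
      ρ * t / 4 ≤ (((Finset.Ico (t / 2) t).filter fun i => L i ω ≤ l).card : ℝ) →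
      l < L t ω → armSeq Γ L X ω t = kstar := by
  have hlogt : Filter.Tendsto (fun t : ℕ => Real.log ((t : ℝ) + 1)) Filter.atTop Filter.atTop :=
    Real.tendsto_log_atTop.comp
      (Filter.tendsto_atTop_add_const_right _ _ tendsto_natCast_atTop_atTop)
  have hinv : Filter.Tendsto (fun t : ℕ => 1 / (t : ℝ)) Filter.atTop (nhds 0) :=
    tendsto_one_div_atTop_nhds_zero_nat
  have hlogdiv : Filter.Tendsto (fun t : ℕ => Real.log ((t : ℝ) + 1) / t) Filter.atTop
      (nhds 0) := by
    have h1 : Filter.Tendsto (fun t : ℕ => Real.log ((t : ℝ) + 1) / ((t : ℝ) + 1)) Filter.atTop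
        (nhds 0) := (Real.isLittleO_log_id_atTop.tendsto_div_nhds_zero).comp
      (Filter.tendsto_atTop_add_const_right _ _ tendsto_natCast_atTop_atTop)
    have h2 := h1.mul (hinv.const_add 1)
    rw [zero_mul] at h2
    refine h2.congr' ?_
    filter_upwards [Filter.eventually_gt_atTop 0] with t ht
    have : (0 : ℝ) < t := by exact_mod_cast ht
    field_simp
  -- The right side is `ρ / 4 - ρ / 16`, per unit of `t`: the low-load slots left once the pulls of
  -- the best arm are set aside.
  have hsum : ∀ᶠ t : ℕ in Filter.atTop,
      (∑ k ∈ Finset.univ.erase kstar, 4 * α / (u kstar - u k) ^ 2) * (Real.log ((t : ℝ) + 1) / t) +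
        ((Finset.univ.erase kstar).card + 1 : ℝ) * (1 / t) < 3 * ρ / 16 := by
    have h := (hlogdiv.const_mul (∑ k ∈ Finset.univ.erase kstar,
      4 * α / (u kstar - u k) ^ 2)).add (hinv.const_mul ((Finset.univ.erase kstar).card + 1 : ℝ))
    rw [mul_zero, mul_zero, add_zero] at h
    exact h.eventually_lt_const (by positivity)
  have heps : ∀ᶠ t : ℕ in Filter.atTop, ∀ k, k ≠ kstar →
      (1.05 + √α) * √(16 / ρ * (Real.log ((t : ℝ) + 1) / t)) ≤ (u kstar - u k) / 200 := by
    refine Filter.eventually_all.2 fun k => ?_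
    by_cases hk : k = kstar
    · simp [hk]
    have h := ((hlogdiv.const_mul (16 / ρ)).sqrt).const_mul (1.05 + √α)
    rw [mul_zero, Real.sqrt_zero, mul_zero] at h
    have hpos : 0 < (u kstar - u k) / 200 := div_pos (sub_pos.2 (hbest k hk)) (by norm_num)
    filter_upwards [h.eventually_lt_const hpos] with t ht _ using ht.le
  -- Passing from `t` to `t / 2` costs at most `log 2` in the logarithm, and `2 (r - log 2) ≥ 1.96
  -- r` once `r ≥ 50 log 2`. The bound `2 K + 2` places the whole window after the initial slots.
  obtain ⟨t₀, ht₀⟩ := Filter.eventually_atTop.1 (hsum.and (heps.and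
    ((hlogt.eventually_ge_atTop (50 * Real.log 2)).and
      (Filter.eventually_ge_atTop (2 * K + 2)))))
  refine ⟨t₀, fun t ht => ?_⟩
  obtain ⟨h1, h2, h3, h4⟩ := ht₀ t ht
  refine ⟨by omega, fun Ω L X l Γ hΓ ω hω hcard hhigh => ?_⟩
  have ht0 : (0 : ℝ) < t := by
    have : 0 < t := by omega
    exact_mod_cast this
  refine high_load_pull_eq_best (low := fun i => L i ω ≤ l) hα.le hρ hbest
    (fun n hn => one_le_armCount hΓ _ _ hn) (fun n hn hlow => index_le_of_low hΓ hn hlow)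
    (index_le_of_high hΓ (by omega) hhigh) hω.1 hω.2 hcard (by omega) (by omega) ?_ ?_ ?_
  · have e : Real.log ((t : ℝ) + 1) - Real.log 2 ≤ Real.log ((t / 2 : ℕ) + 1) := by
      rw [← Real.log_div (by positivity) (by norm_num)]
      refine Real.log_le_log (by positivity) ?_
      have : t + 1 ≤ 2 * (t / 2 + 1) := by omega
      have : (t : ℝ) + 1 ≤ 2 * ((t / 2 : ℕ) + 1) := by exact_mod_cast this
      linarith
    have h0 : 0 ≤ Real.log (((t / 2 : ℕ) : ℝ) + 1) := Real.log_nonneg (by simp)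
    nlinarith
  · have e : ∑ k ∈ Finset.univ.erase kstar,
        (4 * α * Real.log (t + 1) / (u kstar - u k) ^ 2 + 1) + 1 =
        ((∑ k ∈ Finset.univ.erase kstar, 4 * α / (u kstar - u k) ^ 2) *
          (Real.log ((t : ℝ) + 1) / t) +
        ((Finset.univ.erase kstar).card + 1 : ℝ) * (1 / t)) * t := by
      have e' : ∑ k ∈ Finset.univ.erase kstar, 4 * α * Real.log (t + 1) / (u kstar - u k) ^ 2 =
          (∑ k ∈ Finset.univ.erase kstar, 4 * α / (u kstar - u k) ^ 2) *
            Real.log ((t : ℝ) + 1) := by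
        rw [Finset.sum_mul]
        exact Finset.sum_congr rfl fun k _ => by ring
      rw [Finset.sum_add_distrib, Finset.sum_const, nsmul_eq_mul, mul_one, e']
      field_simp
      ring
    nlinarith
  · intro k hk
    have e : Real.log ((t : ℝ) + 1) / (ρ * t / 16) = 16 / ρ * (Real.log ((t : ℝ) + 1) / t) := by
      field_simp
    rw [e]
    exact h2 k hk

end Policy

/-! ### Expected loss of a single slot. -/

section Slot

variable {K : ℕ} {Ω : Type*} [MeasurableSpace Ω] {P : Measure Ω}
  {L : ℕ → Ω → ℝ} {X : Fin K → ℕ → Ω → ℝ} {u : Fin K → ℝ} {Γ : Policy K}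

theorem IsModel.measurable_armSeq (h : IsModel P L X u)
    (hΓ : ∀ n, Measurable fun p : History K n × ℝ => Γ n p.1 p.2) (n : ℕ) :
    Measurable fun ω => armSeq Γ L X ω n :=
  measurable_pulledArm _ hΓ (fun i _ => h.measurable_load i) fun k i _ => h.measurable_reward k i

/-- The expected loss of a slot, weighted by a function of the load, is a combination of the
weighted probabilities that the arms are pulled. -/
theorem IsModel.integral_load_mul_loss [IsProbabilityMeasure P] (h : IsModel P L X u)
    (hΓ : ∀ n, Measurable fun p : History K n × ℝ => Γ n p.1 p.2) {g : ℝ → ℝ} (hg : Measurable g)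
    (hg1 : ∀ y ∈ Set.Icc (0 : ℝ) 1, g y ∈ Set.Icc (0 : ℝ) 1) (v : ℝ) (n : ℕ) :
    ∫ ω, g (L n ω) * (v - receivedReward Γ L X n ω) ∂P =
      ∑ k, (v - u k) * ∫ ω, {ω | armSeq Γ L X ω n = k}.indicator (fun ω => g (L n ω)) ω ∂P := by
  have hA : ∀ k, MeasurableSet[sourceAlgebra L X (pastRewards K n)]
      {ω | armSeq Γ L X ω n = k} := fun k =>
    measurable_armSeq_pastRewards hΓ le_rfl (measurableSet_singleton k)
  have hF : ∀ k, Measurable[sourceAlgebra L X (pastRewards K n)]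
      ({ω | armSeq Γ L X ω n = k}.indicator fun ω => g (L n ω)) := fun k =>
    (hg.comp (measurable_source_sourceAlgebra L X (i := Sum.inl n)
      (by simp [pastRewards]))).indicator (hA k)
  have hFb : ∀ k ω, ‖{ω | armSeq Γ L X ω n = k}.indicator (fun ω => g (L n ω)) ω‖ ≤ 1 := by
    intro k ω
    refine (norm_indicator_le_norm_self _ _).trans ?_
    obtain ⟨h0, h1⟩ := hg1 _ (h.load_mem n ω)
    rwa [Real.norm_of_nonneg h0]
  have hXi : ∀ k, Integrable (X k n) P := fun k =>
    Integrable.of_mem_Icc 0 1 (h.measurable_reward k n).aemeasurable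
      (Filter.Eventually.of_forall (h.reward_mem k n))
  have hvX : ∀ k, Integrable (fun ω => v - X k n ω) P := fun k =>
    (integrable_const v).sub (hXi k)
  have e : ∀ ω, g (L n ω) * (v - receivedReward Γ L X n ω) =
      ∑ k, {ω | armSeq Γ L X ω n = k}.indicator (fun ω => g (L n ω)) ω * (v - X k n ω) := by
    intro ω
    rw [Finset.sum_eq_single (armSeq Γ L X ω n)]
    · rw [Set.indicator_of_mem (by rfl)]
      rfl
    · intro k _ hk
      rw [Set.indicator_of_notMem (by exact fun h => hk h.symm), zero_mul]
    · simp
  simp_rw [e]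
  rw [integral_finsetSum _ fun k _ => (hvX k).bdd_mul
    ((hF k).mono (h.sourceAlgebra_le _) le_rfl).aestronglyMeasurable
    (Filter.Eventually.of_forall (hFb k))]
  refine Finset.sum_congr rfl fun k _ => ?_
  have hm : Measurable[MeasurableSpace.comap (X k n) inferInstance] fun ω => v - X k n ω :=
    (comap_measurable (X k n)).const_sub v
  rw [integral_mul_of_indep (h.sourceAlgebra_le _) (h.measurable_reward k n).comap_le
    (h.indep_reward_past k n).symm (hF k) hm, integral_sub (integrable_const v) (hXi k),
    h.mean_reward, mul_comm]
  simp

theorem IsModel.indep_load_past (h : IsModel P L X u) (n : ℕ) :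
    Indep (MeasurableSpace.comap (L n) inferInstance)
      (sourceAlgebra L X (pastLoads K n)) P := by
  refine indep_of_indep_of_le_left
    (h.indep_sourceAlgebra (S := {Sum.inl n}) (T := pastLoads K n) ?_) ?_
  · exact Set.disjoint_singleton_left.2 fun hk => lt_irrefl n (hk _ rfl)
  · exact (measurable_source_sourceAlgebra L X (i := Sum.inl n) (Set.mem_singleton _)).comap_le

/-- At low load the pulled arm is independent of the load. -/
theorem IsModel.integral_low_load [IsProbabilityMeasure P] (h : IsModel P L X u) {α l : ℝ}
    (hΓ : IsAdaUCB α l l Γ)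
    {g : ℝ → ℝ} (hg : Measurable g) (hgl : ∀ y, l < y → g y = 0) {n : ℕ} (hn : K ≤ n)
    (k : Fin K) :
    ∫ ω, {ω | armSeq Γ L X ω n = k}.indicator (fun ω => g (L n ω)) ω ∂P =
      (∫ ω, g (L 0 ω) ∂P) * P.real {ω |
        Γ n (history Γ (fun i => L i ω) (fun k i => X k i ω) n) l = k} := by
  have hB : MeasurableSet[sourceAlgebra L X (pastLoads K n)] {ω |
      Γ n (history Γ (fun i => L i ω) (fun k i => X k i ω) n) l = k} := by
    have hh : Measurable[sourceAlgebra L X (pastLoads K n)] fun ω =>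
        history Γ (fun i => L i ω) (fun k i => X k i ω) n :=
      measurable_history _ hΓ.measurable
        (fun j hj => measurable_source_sourceAlgebra L X (i := Sum.inl j)
          (by simp [pastLoads]; omega))
        fun k j hj => measurable_source_sourceAlgebra L X (i := Sum.inr (k, j))
          (by simp [pastLoads])
    exact (hΓ.measurable n).comp (hh.prodMk measurable_const) (measurableSet_singleton k)
  have e : ∀ ω, {ω | armSeq Γ L X ω n = k}.indicator (fun ω => g (L n ω)) ω =
      g (L n ω) * {ω | Γ n (history Γ (fun i => L i ω) (fun k i => X k i ω) n) l = k}.indicator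
        (fun _ => (1 : ℝ)) ω := by
    intro ω
    rcases lt_or_ge l (L n ω) with hl | hl
    · simp [hgl _ hl, Set.indicator_apply]
    -- All low loads have normalized load zero, so the current load may be replaced by the
    -- representative `l`; the choice then depends on the past only.
    · have : armSeq Γ L X ω n = Γ n (history Γ (fun i => L i ω) (fun k i => X k i ω) n) l :=
        hΓ.load_only_normalized n hn _ _ _ (by simp [normalizedLoad, hl])
      simp [Set.indicator_apply, this]
  simp_rw [e]
  have hgm : Measurable[MeasurableSpace.comap (L n) inferInstance] fun ω => g (L n ω) :=
    hg.comp (comap_measurable (L n))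
  rw [integral_mul_of_indep (h.measurable_load n).comap_le (h.sourceAlgebra_le _)
    (h.indep_load_past n) hgm (measurable_const.indicator hB)]
  congr 1
  · exact ((h.ident_load n).comp hg).integral_eq
  · exact integral_indicator_one (h.sourceAlgebra_le _ _ hB)

end Slot


/-! ### Summing the losses over time. -/

section Regret

variable {K : ℕ} {Ω : Type*} [MeasurableSpace Ω] {P : Measure Ω}
  {L : ℕ → Ω → ℝ} {X : Fin K → ℕ → Ω → ℝ} {u : Fin K → ℝ} {Γ : Policy K} {kstar : Fin K}

theorem IsModel.mean_mem [IsProbabilityMeasure P] (h : IsModel P L X u)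
    (k : Fin K) : u k ∈ Set.Icc (0 : ℝ) 1 := by
  rw [← h.mean_reward k 0]
  refine ⟨integral_nonneg fun ω => (h.reward_mem k 0 ω).1, ?_⟩
  refine (integral_mono (Integrable.of_mem_Icc 0 1 (h.measurable_reward k 0).aemeasurable
    (Filter.Eventually.of_forall (h.reward_mem k 0))) (integrable_const 1)
    fun ω => (h.reward_mem k 0 ω).2).trans ?_
  simp

/-- The constant that bounds the total probability of immoderate noise. -/
def noiseConstant (K : ℕ) : ℝ := ∑' n : ℕ, 3 * K * ((n : ℝ) + 1) ^ (-1.2 : ℝ)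

theorem summable_noise (K : ℕ) : Summable fun n : ℕ => 3 * K * ((n : ℝ) + 1) ^ (-1.2 : ℝ) := by
  refine Summable.mul_left _ ?_
  have h := (summable_nat_add_iff 1).2 (Real.summable_nat_rpow.2 (by norm_num : (-1.2 : ℝ) < -1))
  simpa using h

/-- The number of pulls of a suboptimal arm at low load is logarithmic on average. -/
theorem IsModel.sum_low_pulls_le [IsProbabilityMeasure P] (h : IsModel P L X u)
    {α l : ℝ} (hα : 2 < α)
    (hΓ : IsAdaUCB α l l Γ) (hbest : ∀ k, k ≠ kstar → u k < u kstar) {k : Fin K} (hk : k ≠ kstar)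
    {T : ℕ} (hT : 1 ≤ T) :
    ∑ n ∈ (Finset.range T).filter (fun n => K ≤ n), P.real {ω | L n ω ≤ l ∧ armSeq Γ L X ω n = k} ≤
      4 * α * Real.log T / (u kstar - u k) ^ 2 + 1 + noiseConstant K := by
  set B := 4 * α * Real.log T / (u kstar - u k) ^ 2 with hB
  have hT' : (1 : ℝ) ≤ T := by exact_mod_cast hT
  have hB0 : 0 ≤ B := by
    have := Real.log_nonneg hT'
    positivity
  set A : ℕ → Set Ω := fun n => {ω | armSeq Γ L X ω n = k ∧
    (armCount (armSeq Γ L X ω) k n : ℝ) ≤ B} with hA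
  have hAm : ∀ n, MeasurableSet (A n) := fun n =>
    MeasurableSet.inter (h.measurable_armSeq hΓ.measurable n (measurableSet_singleton k))
      (measurable_armCount _ (fun i _ => h.measurable_armSeq hΓ.measurable i) k
        (MeasurableSet.of_discrete (s := {c : ℕ | (c : ℝ) ≤ B})))
  have hstep : ∀ n ∈ (Finset.range T).filter (fun n => K ≤ n),
      P.real {ω | L n ω ≤ l ∧ armSeq Γ L X ω n = k} ≤
        P.real (A n) + 3 * K * ((n : ℝ) + 1) ^ (-1.2 : ℝ) := by
    intro n hn
    obtain ⟨hnT, hKn⟩ := Finset.mem_filter.1 hn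
    -- Slot `n`, counted from zero, explores with `log (n + 1)`, so `n < T` gives exactly `log T`.
    have hnT' : (n : ℝ) + 1 ≤ T := by exact_mod_cast Finset.mem_range.1 hnT
    refine (measureReal_mono (s₂ := A n ∪ (moderateNoise Γ L X u n)ᶜ) ?_).trans
      ((measureReal_union_le _ _).trans
        (add_le_add le_rfl (h.measure_compl_moderateNoise_le hΓ.measurable n)))
    rintro ω ⟨hlow, rfl⟩
    by_cases hm : ω ∈ moderateNoise Γ L X u n
    · refine Or.inl ⟨rfl, (armCount_le_of_moderateNoise hα hΓ hbest hKn hm hlow hk).trans ?_⟩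
      have : Real.log ((n : ℝ) + 1) ≤ Real.log T := Real.log_le_log (by positivity) hnT'
      rw [hB]
      gcongr
    · exact Or.inr hm
  -- On every outcome at most `B + 1` of the events `A n` occur; integrating this pathwise bound
  -- avoids any estimate of single probabilities.
  have hsumA : ∑ n ∈ Finset.range T, P.real (A n) ≤ B + 1 := by
    have hi : ∀ n ∈ Finset.range T, Integrable ((A n).indicator fun _ => (1 : ℝ)) P :=
      fun n _ => (integrable_const 1).indicator (hAm n)
    have e : ∀ n, P.real (A n) = ∫ ω, (A n).indicator (fun _ => (1 : ℝ)) ω ∂P :=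
      fun n => (integral_indicator_one (hAm n)).symm
    simp_rw [e]
    rw [← integral_finsetSum _ hi]
    refine (integral_mono (integrable_finsetSum _ hi) (integrable_const (B + 1))
      fun ω => ?_).trans (by simp)
    have hc := card_le_of_armCount_le (armSeq Γ L X ω) k (B := B)
      (s := (Finset.range T).filter fun n => armSeq Γ L X ω n = k ∧
        (armCount (armSeq Γ L X ω) k n : ℝ) ≤ B) hB0 (fun n hn => (Finset.mem_filter.1 hn).2)
    refine le_trans (le_of_eq ?_) hc
    rw [Finset.card_filter]
    push_cast
    refine Finset.sum_congr rfl fun n _ => ?_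
    simp only [Set.indicator_apply, hA, Set.mem_ofPred_eq]
  refine (Finset.sum_le_sum hstep).trans ?_
  rw [Finset.sum_add_distrib]
  refine add_le_add (le_trans (Finset.sum_le_sum_of_subset_of_nonneg (Finset.filter_subset _ _)
    fun _ _ _ => measureReal_nonneg) hsumA) ?_
  exact (summable_noise K).sum_le_tsum _ fun n _ => by positivity

theorem sum_range_le_of_eventually_le {f q : ℕ → ℝ} {t₀ : ℕ} (hf : ∀ t, f t ≤ 1)
    (hq : ∀ t, 0 ≤ q t) (hqs : Summable q) (hfq : ∀ t, t₀ ≤ t → f t ≤ q t) (T : ℕ) :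
    ∑ t ∈ Finset.range T, f t ≤ t₀ + ∑' t, q t := by
  have hstep : ∀ t ∈ Finset.range T, f t ≤ (if t < t₀ then 1 else 0) + q t := by
    intro t _
    split_ifs with h
    · linarith [hf t, hq t]
    · linarith [hfq t (not_lt.1 h)]
  refine (Finset.sum_le_sum hstep).trans ?_
  rw [Finset.sum_add_distrib]
  refine add_le_add ?_ (hqs.sum_le_tsum _ fun t _ => hq t)
  rw [Finset.sum_boole]
  have hc : ((Finset.range T).filter fun t => t < t₀).card ≤ (Finset.range t₀).card :=
    Finset.card_le_card fun t ht => Finset.mem_range.2 (Finset.mem_filter.1 ht).2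
  rw [Finset.card_range] at hc
  exact_mod_cast hc

/-- Loads and gaps are bounded by one. This crude bound suffices for the initial slots and for high
load, which contribute only constants. -/
theorem IsModel.integral_load_mul_loss_le [IsProbabilityMeasure P] (h : IsModel P L X u)
    (hΓ : ∀ n, Measurable fun p : History K n × ℝ => Γ n p.1 p.2)
    (hbest : ∀ k, k ≠ kstar → u k < u kstar) {S : Set ℝ} (hS : MeasurableSet S) (n : ℕ) :
    ∫ ω, S.indicator id (L n ω) * (u kstar - receivedReward Γ L X n ω) ∂P ≤
      ∑ k ∈ Finset.univ.erase kstar, P.real {ω | L n ω ∈ S ∧ armSeq Γ L X ω n = k} := by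
  have hg : Measurable (S.indicator (id : ℝ → ℝ)) := measurable_id.indicator hS
  have hg1 : ∀ y ∈ Set.Icc (0 : ℝ) 1, S.indicator id y ∈ Set.Icc (0 : ℝ) 1 := by
    intro y hy
    by_cases hyS : y ∈ S
    · simpa [hyS] using hy
    · simp [hyS]
  rw [h.integral_load_mul_loss hΓ hg hg1, ← Finset.add_sum_erase _ _ (Finset.mem_univ kstar),
    sub_self, zero_mul, zero_add]
  refine Finset.sum_le_sum fun k hk => ?_
  have hΔ0 := (sub_pos.2 (hbest k (Finset.ne_of_mem_erase hk))).le
  have hΔ1 : u kstar - u k ≤ 1 := by linarith [(h.mean_mem k).1, (h.mean_mem kstar).2]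
  have hk := h.measurable_armSeq hΓ n (measurableSet_singleton k)
  have hm : MeasurableSet {ω | L n ω ∈ S ∧ armSeq Γ L X ω n = k} :=
    MeasurableSet.inter (h.measurable_load n hS) hk
  have hle : ∫ ω, {ω | armSeq Γ L X ω n = k}.indicator (fun ω => S.indicator id (L n ω)) ω ∂P ≤
      P.real {ω | L n ω ∈ S ∧ armSeq Γ L X ω n = k} := by
    rw [← integral_indicator_one hm]
    refine integral_mono_of_nonneg (Filter.Eventually.of_forall fun ω => ?_)
      ((integrable_const 1).indicator hm) (Filter.Eventually.of_forall fun ω => ?_)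
    · exact Set.indicator_nonneg (fun ω _ => (hg1 _ (h.load_mem n ω)).1) ω
    · have := (hg1 _ (h.load_mem n ω)).2
      by_cases h1 : armSeq Γ L X ω n = k <;> by_cases h2 : L n ω ∈ S <;>
        simp_all
  calc _ ≤ (u kstar - u k) * P.real {ω | L n ω ∈ S ∧ armSeq Γ L X ω n = k} :=
        mul_le_mul_of_nonneg_left hle hΔ0
    _ ≤ _ := mul_le_of_le_one_left measureReal_nonneg hΔ1

/-- The expected loss of a slot at low load after the initial slots. -/
theorem IsModel.integral_low_load_mul_loss [IsProbabilityMeasure P] (h : IsModel P L X u)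
    {α l ρ : ℝ} (hρ0 : 0 < ρ)
    (hρ : P.real {ω | L 0 ω ≤ l} = ρ) (hΓ : IsAdaUCB α l l Γ) {n : ℕ} (hn : K ≤ n) :
    ∫ ω, (Set.Iic l).indicator id (L n ω) * (u kstar - receivedReward Γ L X n ω) ∂P =
      (∫ ω, L 0 ω ∂P[|{ω | L 0 ω ≤ l}]) * ∑ k ∈ Finset.univ.erase kstar,
        (u kstar - u k) * P.real {ω | L n ω ≤ l ∧ armSeq Γ L X ω n = k} := by
  have hg : Measurable ((Set.Iic l).indicator (id : ℝ → ℝ)) :=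
    measurable_id.indicator measurableSet_Iic
  have hg' : Measurable ((Set.Iic l).indicator fun _ => (1 : ℝ)) :=
    measurable_const.indicator measurableSet_Iic
  have hg1 : ∀ y ∈ Set.Icc (0 : ℝ) 1, (Set.Iic l).indicator id y ∈ Set.Icc (0 : ℝ) 1 := by
    intro y hy
    by_cases hyS : y ∈ Set.Iic l
    · rwa [Set.indicator_of_mem hyS]
    · rw [Set.indicator_of_notMem hyS]; simp
  have hlow : MeasurableSet {ω | L 0 ω ≤ l} := h.measurable_load 0 measurableSet_Iic
  have hcond : ∫ ω, (Set.Iic l).indicator id (L 0 ω) ∂P =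
      ρ * ∫ ω, L 0 ω ∂P[|{ω | L 0 ω ≤ l}] := by
    rw [ProbabilityTheory.cond, integral_smul_measure, ENNReal.toReal_inv, smul_eq_mul,
      ← measureReal_def, hρ, ← mul_assoc, mul_inv_cancel₀ hρ0.ne', one_mul,
      ← integral_indicator hlow]
    rfl
  have hone : ∫ ω, (Set.Iic l).indicator (fun _ => (1 : ℝ)) (L 0 ω) ∂P = ρ := by
    rw [← hρ, ← integral_indicator_one hlow]
    rfl
  rw [h.integral_load_mul_loss hΓ.measurable hg hg1,
    ← Finset.add_sum_erase _ _ (Finset.mem_univ kstar), sub_self, zero_mul, zero_add,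
    Finset.mul_sum]
  refine Finset.sum_congr rfl fun k _ => ?_
  have hm : MeasurableSet {ω | L n ω ≤ l ∧ armSeq Γ L X ω n = k} :=
    MeasurableSet.inter (h.measurable_load n measurableSet_Iic)
      (h.measurable_armSeq hΓ.measurable n (measurableSet_singleton k))
  -- `IsModel.integral_low_load` with weight one in place of the load. Dividing the two instances
  -- replaces `ρ` by the conditional mean load.
  have hP : P.real {ω | L n ω ≤ l ∧ armSeq Γ L X ω n = k} = ρ * P.real {ω |
      Γ n (history Γ (fun i => L i ω) (fun k i => X k i ω) n) l = k} := by
    rw [← hone, ← h.integral_low_load hΓ hg' (fun y hy => Set.indicator_of_notMem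
      (by simpa using hy) _) hn k, ← integral_indicator_one hm]
    refine integral_congr_ae (Filter.Eventually.of_forall fun ω => ?_)
    by_cases h1 : armSeq Γ L X ω n = k <;> by_cases h2 : L n ω ≤ l <;>
      simp [Set.indicator_apply, h1, h2]
  rw [h.integral_low_load hΓ hg (fun y hy => Set.indicator_of_notMem (by simpa using hy) _) hn k,
    hcond, hP]
  ring

theorem iSup_eq_of_best (hbest : ∀ k, k ≠ kstar → u k < u kstar) : ⨆ k, u k = u kstar := by
  have : Nonempty (Fin K) := ⟨kstar⟩
  refine le_antisymm (ciSup_le fun k => ?_) (le_ciSup (Set.finite_range u).bddAbove kstar)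
  by_cases hk : k = kstar
  · rw [hk]
  · exact (hbest k hk).le

theorem IsModel.measurable_receivedReward (h : IsModel P L X u)
    (hΓ : ∀ n, Measurable fun p : History K n × ℝ => Γ n p.1 p.2) (n : ℕ) :
    Measurable (receivedReward Γ L X n) :=
  (measurable_from_prod_countable_right (f := fun p : Fin K × Ω => X p.1 n p.2)
    fun k => h.measurable_reward k n).comp ((h.measurable_armSeq hΓ n).prodMk measurable_id)

/-- The regret is the loss at low load and the loss at high load. -/
theorem IsModel.regret_eq [IsProbabilityMeasure P] (h : IsModel P L X u)
    (hΓ : ∀ n, Measurable fun p : History K n × ℝ => Γ n p.1 p.2)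
    (hbest : ∀ k, k ≠ kstar → u k < u kstar) (l : ℝ) (T : ℕ) :
    regret P L X u Γ T =
      ∑ n ∈ Finset.range T, ∫ ω, (Set.Iic l).indicator id (L n ω) *
        (u kstar - receivedReward Γ L X n ω) ∂P +
      ∑ n ∈ Finset.range T, ∫ ω, (Set.Ioi l).indicator id (L n ω) *
        (u kstar - receivedReward Γ L X n ω) ∂P := by
  have hLi : ∀ n, Integrable (L n) P := fun n =>
    Integrable.of_mem_Icc 0 1 (h.measurable_load n).aemeasurable
      (Filter.Eventually.of_forall (h.load_mem n))
  have hRi : ∀ n, Integrable (receivedReward Γ L X n) P := fun n =>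
    Integrable.of_mem_Icc 0 1 (h.measurable_receivedReward hΓ n).aemeasurable
      (Filter.Eventually.of_forall fun ω => h.reward_mem _ n ω)
  have hbd : ∀ (S : Set ℝ) n, MeasurableSet S → ∀ {f : Ω → ℝ}, Integrable f P →
      Integrable (fun ω => S.indicator id (L n ω) * f ω) P := by
    intro S n hS f hf
    refine hf.bdd_mul (c := 1) ((measurable_id.indicator hS).comp
      (h.measurable_load n)).aestronglyMeasurable (Filter.Eventually.of_forall fun ω => ?_)
    refine (norm_indicator_le_norm_self _ _).trans ?_
    obtain ⟨h0, h1⟩ := h.load_mem n ω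
    rwa [id, Real.norm_of_nonneg h0]
  have hLR : ∀ n, Integrable (fun ω => L n ω * receivedReward Γ L X n ω) P := fun n => by
    simpa using hbd Set.univ n MeasurableSet.univ (hRi n)
  rw [regret, iSup_eq_of_best hbest, integral_finsetSum _ fun n _ => hLi n, Finset.mul_sum,
    ← Finset.sum_sub_distrib, ← Finset.sum_add_distrib]
  refine Finset.sum_congr rfl fun n _ => ?_
  have hD : Integrable (fun ω => u kstar - receivedReward Γ L X n ω) P :=
    (integrable_const _).sub (hRi n)
  rw [← integral_const_mul, ← integral_sub ((hLi n).const_mul _) (hLR n),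
    ← integral_add (hbd _ n measurableSet_Iic hD) (hbd _ n measurableSet_Ioi hD)]
  refine integral_congr_ae (Filter.Eventually.of_forall fun ω => ?_)
  rcases le_or_gt (L n ω) l with hl | hl
  · simp [hl, hl.not_gt]; ring
  · simp [hl, hl.not_ge]; ring

theorem IsModel.highLoadRegret_eq (h : IsModel P L X u)
    (hbest : ∀ k, k ≠ kstar → u k < u kstar) (l : ℝ) (T : ℕ) :
    highLoadRegret P L X u Γ l T = ∑ n ∈ Finset.range T, ∫ ω, (Set.Ioi l).indicator id (L n ω) *
        (u kstar - receivedReward Γ L X n ω) ∂P := by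
  refine Finset.sum_congr rfl fun n _ => ?_
  have hm : MeasurableSet {ω | l < L n ω} := h.measurable_load n measurableSet_Ioi
  rw [iSup_eq_of_best hbest, ← integral_indicator hm]
  refine integral_congr_ae (Filter.Eventually.of_forall fun ω => ?_)
  by_cases hl : l < L n ω <;> simp [hl]

theorem IsModel.cond_load_mem [IsProbabilityMeasure P] (h : IsModel P L X u)
    {l ρ : ℝ} (hρ0 : 0 < ρ)
    (hρ : P.real {ω | L 0 ω ≤ l} = ρ) :
    ∫ ω, L 0 ω ∂P[|{ω | L 0 ω ≤ l}] ∈ Set.Icc (0 : ℝ) 1 := by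
  have hne : P {ω | L 0 ω ≤ l} ≠ 0 := by
    intro h0
    rw [measureReal_def, h0] at hρ
    simp at hρ
    linarith
  have := cond_isProbabilityMeasure hne
  refine ⟨integral_nonneg fun ω => (h.load_mem 0 ω).1, ?_⟩
  refine (integral_mono (Integrable.of_mem_Icc 0 1 (h.measurable_load 0).aemeasurable
    (Filter.Eventually.of_forall (h.load_mem 0))) (integrable_const 1)
    fun ω => (h.load_mem 0 ω).2).trans ?_
  simp

/-- The loss at low load is at most logarithmic. -/
theorem IsModel.sum_low_load_le [IsProbabilityMeasure P] (h : IsModel P L X u)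
    {α l ρ : ℝ} (hα : 2 < α) (hρ0 : 0 < ρ)
    (hρ : P.real {ω | L 0 ω ≤ l} = ρ) (hΓ : IsAdaUCB α l l Γ)
    (hbest : ∀ k, k ≠ kstar → u k < u kstar) {T : ℕ} (hT : 1 ≤ T) :
    ∑ n ∈ Finset.range T, ∫ ω, (Set.Iic l).indicator id (L n ω) *
        (u kstar - receivedReward Γ L X n ω) ∂P ≤
      4 * α * Real.log T * (∫ ω, L 0 ω ∂P[|{ω | L 0 ω ≤ l}]) *
        (∑ k ∈ Finset.univ.erase kstar, 1 / (u kstar - u k)) +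
      (K * K + K * (1 + noiseConstant K)) := by
  obtain ⟨hm0, hm1⟩ := h.cond_load_mem hρ0 hρ
  set μ := ∫ ω, L 0 ω ∂P[|{ω | L 0 ω ≤ l}] with hμ
  have hcard : ((Finset.univ.erase kstar).card : ℝ) ≤ K := by
    have := Finset.card_le_univ (Finset.univ.erase kstar)
    rw [Fintype.card_fin] at this
    exact_mod_cast this
  have hD : 0 ≤ 1 + noiseConstant K :=
    add_nonneg zero_le_one (tsum_nonneg fun n => by positivity)
  have hinit : ∑ n ∈ (Finset.range T).filter (fun n => ¬ K ≤ n),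
      ∫ ω, (Set.Iic l).indicator id (L n ω) * (u kstar - receivedReward Γ L X n ω) ∂P ≤
      K * K := by
    refine (Finset.sum_le_card_nsmul _ _ (K : ℝ) fun n _ => ?_).trans ?_
    · refine (h.integral_load_mul_loss_le hΓ.measurable hbest measurableSet_Iic n).trans ?_
      refine (Finset.sum_le_card_nsmul _ _ 1 fun k _ => measureReal_le_one).trans ?_
      simpa [-Finset.card_erase_of_mem] using hcard
    · rw [nsmul_eq_mul]
      refine mul_le_mul_of_nonneg_right ?_ (by positivity)
      have : ((Finset.range T).filter fun n => ¬ K ≤ n).card ≤ (Finset.range K).card :=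
        Finset.card_le_card fun n hn =>
          Finset.mem_range.2 (not_le.1 (Finset.mem_filter.1 hn).2)
      rw [Finset.card_range] at this
      exact_mod_cast this
  have hmain : ∑ n ∈ (Finset.range T).filter (fun n => K ≤ n),
      ∫ ω, (Set.Iic l).indicator id (L n ω) * (u kstar - receivedReward Γ L X n ω) ∂P ≤
      4 * α * Real.log T * μ * (∑ k ∈ Finset.univ.erase kstar, 1 / (u kstar - u k)) +
        K * (1 + noiseConstant K) := by
    rw [Finset.sum_congr rfl fun n hn =>
      h.integral_low_load_mul_loss (kstar := kstar) hρ0 hρ hΓ (Finset.mem_filter.1 hn).2,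
      ← Finset.mul_sum, Finset.sum_comm]
    have hk : ∀ k ∈ Finset.univ.erase kstar, ∑ n ∈ (Finset.range T).filter (fun n => K ≤ n),
        (u kstar - u k) * P.real {ω | L n ω ≤ l ∧ armSeq Γ L X ω n = k} ≤
        4 * α * Real.log T * (1 / (u kstar - u k)) + (1 + noiseConstant K) := by
      intro k hk
      have hk' := Finset.ne_of_mem_erase hk
      have hΔ0 := sub_pos.2 (hbest k hk')
      have hΔ1 : u kstar - u k ≤ 1 := by linarith [(h.mean_mem k).1, (h.mean_mem kstar).2]
      rw [← Finset.mul_sum]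
      refine (mul_le_mul_of_nonneg_left (h.sum_low_pulls_le hα hΓ hbest hk' hT) hΔ0.le).trans ?_
      rw [add_assoc, mul_add]
      refine add_le_add (le_of_eq ?_) (mul_le_of_le_one_left hD hΔ1)
      field_simp
    -- Only the logarithmic term keeps the factor `μ`; in the constant term it is bounded by one.
    calc _ ≤ μ * ∑ k ∈ Finset.univ.erase kstar,
          (4 * α * Real.log T * (1 / (u kstar - u k)) + (1 + noiseConstant K)) :=
          mul_le_mul_of_nonneg_left (Finset.sum_le_sum hk) hm0
      _ = 4 * α * Real.log T * μ * (∑ k ∈ Finset.univ.erase kstar, 1 / (u kstar - u k)) +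
          μ * ((Finset.univ.erase kstar).card * (1 + noiseConstant K)) := by
          rw [Finset.sum_add_distrib, ← Finset.mul_sum, Finset.sum_const, nsmul_eq_mul]
          ring
      _ ≤ _ := by
          exact add_le_add le_rfl ((mul_le_of_le_one_left (by positivity) hm1).trans (by gcongr))
  rw [← Finset.sum_filter_add_sum_filter_not (Finset.range T) (fun n => K ≤ n)]
  linarith

/-- The probability of a pull of a suboptimal arm at high load. -/
theorem IsModel.measure_high_pull_le [IsProbabilityMeasure P] (h : IsModel P L X u)
    {α l ρ : ℝ} (hρ0 : 0 < ρ)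
    (hρ : P.real {ω | L 0 ω ≤ l} = ρ) (hΓ : IsAdaUCB α l l Γ) {t : ℕ} (ht : 0 < t)
    (hpull : ∀ ω ∈ moderateNoise Γ L X u t,
      ρ * t / 4 ≤ (((Finset.Ico (t / 2) t).filter fun i => L i ω ≤ l).card : ℝ) →
      l < L t ω → armSeq Γ L X ω t = kstar) {k : Fin K} (hk : k ≠ kstar) :
    P.real {ω | L t ω ∈ Set.Ioi l ∧ armSeq Γ L X ω t = k} ≤
      3 * K * ((t : ℝ) + 1) ^ (-1.2 : ℝ) + Real.exp (-(ρ ^ 2 / 4 * t)) := by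
  refine (measureReal_mono (s₂ := (moderateNoise Γ L X u t)ᶜ ∪ {ω |
    (((Finset.Ico (t / 2) t).filter fun i => L i ω ≤ l).card : ℝ) < ρ * t / 4}) ?_).trans
      ((measureReal_union_le _ _).trans (add_le_add
        (h.measure_compl_moderateNoise_le hΓ.measurable t) (h.measure_low_count_lt_le hρ0 hρ ht)))
  rintro ω ⟨hl, rfl⟩
  by_contra hω
  simp only [Set.mem_union, Set.mem_compl_iff, Set.mem_ofPred_eq, not_or, not_not, not_lt] at hω
  exact hk (hpull ω hω.1 hω.2 hl)

/-- The loss at high load is bounded. -/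
theorem IsModel.sum_high_load_le [IsProbabilityMeasure P] (h : IsModel P L X u)
    {α l ρ : ℝ} (hρ0 : 0 < ρ)
    (hρ : P.real {ω | L 0 ω ≤ l} = ρ) (hΓ : IsAdaUCB α l l Γ)
    (hbest : ∀ k, k ≠ kstar → u k < u kstar) {t₀ : ℕ} (ht₀ : ∀ t, t₀ ≤ t → 0 < t ∧
      ∀ ω ∈ moderateNoise Γ L X u t,
      ρ * t / 4 ≤ (((Finset.Ico (t / 2) t).filter fun i => L i ω ≤ l).card : ℝ) →
      l < L t ω → armSeq Γ L X ω t = kstar) (T : ℕ) :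
    ∑ n ∈ Finset.range T, ∫ ω, (Set.Ioi l).indicator id (L n ω) *
        (u kstar - receivedReward Γ L X n ω) ∂P ≤
      K * (t₀ + ∑' t : ℕ, (3 * K * ((t : ℝ) + 1) ^ (-1.2 : ℝ) + Real.exp (-(ρ ^ 2 / 4 * t)))) := by
  have hexp : Summable fun t : ℕ => Real.exp (-(ρ ^ 2 / 4 * t)) := by
    have := Real.summable_exp_nat_mul_iff.2 (show -(ρ ^ 2 / 4) < 0 by simp; positivity)
    refine this.congr fun t => ?_
    ring_nf
  refine (Finset.sum_le_sum fun n _ =>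
    h.integral_load_mul_loss_le hΓ.measurable hbest measurableSet_Ioi n).trans ?_
  rw [Finset.sum_comm]
  refine (Finset.sum_le_card_nsmul _ _ _ fun k hk => sum_range_le_of_eventually_le
    (t₀ := t₀) (fun t => measureReal_le_one) (fun t => by positivity)
    ((summable_noise K).add hexp) (fun t ht => h.measure_high_pull_le hρ0 hρ hΓ (ht₀ t ht).1
      (ht₀ t ht).2 (Finset.ne_of_mem_erase hk)) T).trans ?_
  rw [nsmul_eq_mul]
  refine mul_le_mul_of_nonneg_right ?_
    (add_nonneg (by positivity) (tsum_nonneg fun t => by positivity))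
  have := Finset.card_le_univ (Finset.univ.erase kstar)
  rw [Fintype.card_fin] at this
  exact_mod_cast this

end Regret

end OpportunisticBandit

end

theorem theorem3 (K : ℕ) (α : ℝ) (hα : 2 < α) (ρ : ℝ) (hρ : 0 < ρ)
    (u : Fin K → ℝ) (kstar : Fin K) (hbest : ∀ k, k ≠ kstar → u k < u kstar) :
    ∃ C : ℝ, ∀ (Ω : Type*) [MeasurableSpace Ω] (P : Measure Ω) [IsProbabilityMeasure P]
      (L : ℕ → Ω → ℝ) (X : Fin K → ℕ → Ω → ℝ) (l : ℝ) (Γ : OpportunisticBandit.Policy K),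
      OpportunisticBandit.IsModel P L X u →
      P.real {ω | L 0 ω ≤ l} = ρ →
      OpportunisticBandit.IsAdaUCB α l l Γ →
      ∀ T : ℕ, 1 ≤ T →
        OpportunisticBandit.regret P L X u Γ T ≤
            4 * α * Real.log T * (∫ ω, L 0 ω ∂P[|{ω | L 0 ω ≤ l}]) *
              (∑ k ∈ Finset.univ.erase kstar, 1 / (u kstar - u k)) + C ∧
          OpportunisticBandit.highLoadRegret P L X u Γ l T ≤ C := by
  obtain ⟨t₀, ht₀⟩ := OpportunisticBandit.exists_high_load_pull_eq_best hα hρ hbest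
  -- The sum of the low-load and high-load constants. The time `t₀` was obtained before the
  -- probability space, the threshold and the policy, so none of them enters.
  refine ⟨K * K + K * (1 + OpportunisticBandit.noiseConstant K) + K * (t₀ + ∑' t : ℕ,
    (3 * K * ((t : ℝ) + 1) ^ (-1.2 : ℝ) + Real.exp (-(ρ ^ 2 / 4 * t)))), ?_⟩
  intro Ω _ P _ L X l Γ h hl hΓ T hT
  have hhigh := h.sum_high_load_le hρ hl hΓ hbest
    (fun t ht => ⟨(ht₀ t ht).1, (ht₀ t ht).2 Ω L X l Γ hΓ⟩) T
  have hlow := h.sum_low_load_le hα hρ hl hΓ hbest hT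
  have hD : 0 ≤ OpportunisticBandit.noiseConstant K := tsum_nonneg fun n => by positivity
  rw [h.regret_eq hΓ.measurable hbest l, h.highLoadRegret_eq hbest]
  refine ⟨by linarith, hhigh.trans (le_add_of_nonneg_left (by positivity))⟩
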